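/- Let $n\ge 1$. **Noncrossing partitions.** A set partition of $\{1,\dots,n\}$ is *noncrossing* if there are no $i<j<k<l$ with $i,k$ in one block and $j,l$ in a different block. $NC_n$ is the set of noncrossing partitions, ordered by $x\le y$ iff $y$ refines $x$ (so the one-block partition is the minimum). For $x\in NC_n$ let $\bar x\in\mathfrak S_n$ be the permutation having, for each block $\{b_1<\dots<b_k\}$ of $x$, the cycle $b_1\mapsto b_2\mapsto\dots\mapsto b_k\mapsto b_1$. Permutations are composed from right to left. **EL-labelings.** Let $\lambda(x,y)$ be a function on the cover relations $x\lessdot y$ of $NC_n$ with values in a totally ordered set. It is an *EL-labeling* if every interval $[x,y]$ has exactly one maximal chain whose word of labels is strictly increasing, and this word is lexicographically minimal among the words of all maximal chains of $[x,y]$. It is *injective on covers* if $\lambda(x,y)\ne\lambda(x,y')$ for distinct upper covers $y,y'$ of the same element $x$. **Noncrossing 2-partitions.** ${}^2\Pi_n$ is the set of triples $(\pi,\rho,\ell)$ where $\pi\in NC_n$, $\rho$ is a set partition of $\{1,\dots,n\}$, and $\ell$ is a bijection from the blocks of $\pi$ to the blocks of $\rho$ with $|\ell(B)|=|B|$. It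 is ordered by: $(\pi',\rho',\ell')\le(\pi,\rho,\ell)$ iff $\pi$ refines $\pi'$, $\rho$ refines $\rho'$, and whenever a block $B'$ of $\pi'$ is the disjoint union of blocks $B_1,\dots,B_j$ of $\pi$, then $\ell'(B')=\ell(B_1)\uplus\dots\uplus\ell(B_j)$. An element is also written as a pair $(\pi,\sigma)$, where $\sigma\in\mathfrak S_n$ is the unique permutation that maps each block $B$ of $\pi$ increasingly onto $\ell(B)$. $\hat{{}^2\Pi}_n$ is ${}^2\Pi_n$ with a new maximum $\hat 1$ added; joins $\vee$ are taken in $\hat{{}^2\Pi}_n$. **Orders on upper covers.** The *code* of $\sigma\in\mathfrak S_n$ is the word $\gamma(\sigma)=c_n(\sigma)\cdots c_1(\sigma)$ with $c_i(\sigma)=\#\{j<i:\sigma^{-1}(j)>\sigma^{-1}(i)\}$; codes are compared lexicographically. Given an EL-labeling $\lambda$ of $NC_n$ that is injective on covers, and $\phi=(\pi,\sigma)\in{}^2\Pi_n$, let, for upper covers $(\rho,\tau),(\rho',\tau')\in{}^2\Pi_n$ of $\phi$, $$(\rho,\tau)\prec_\phi(\rho',\tau')\iff \gamma(\tau)<\gamma(\tau'),\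 \text{or}\ \gamma(\tau)=\gamma(\tau')\ \text{and}\ \lambda(\pi,\rho)<\lambda(\pi,\rho').$$ A maximal element of ${}^2\Pi_n$ has $\hat 1$ as its only upper cover, and there is nothing to compare. **Shellings.** A bounded poset is *ranked of length $m$* if all its maximal chains have $m+1$ elements; write such a chain as $p=(p_0\lessdot p_1\lessdot\dots\lessdot p_m)$. Total orders $\prec_x$ on the sets of upper covers induce the lexicographic order on maximal chains: $p'<_{\rm lex}p$ iff $p'\neq p$ and $p'_{j+1}\prec_{p_j}p_{j+1}$ for the minimal $j$ with $p'_{j+1}\ne p_{j+1}$. A *shelling* is a total order $<$ on the maximal chains such that whenever $p'<p$ there is a maximal chain $p''<p$ with $\#(p''\cap p)=m$ and $p'\cap p\subset p''$. **Theorem.** The bounded poset $\hat{{}^2\Pi}_n$ is ranked of length $n$, and: 1. For $x\lessdot y$ in $NC_n$, $\bar y\,\bar x^{-1}$ is a transposition $(i\,j)$ with $i<j$; labeling $x\lessdot y$ by the pair $(i,j)$, with pairs ordered lexicographically, gives an EL-labeling of $NC_n$ that is injective on covers. 2. For every EL-labeling $\lambda$ of $NC_n$ that is injective on covers (with values in any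 totally ordered set): (a) each $\prec_\phi$ is a (strict) total order on the upper covers of $\phi$ in $\hat{{}^2\Pi}_n$, and the induced order $<_{\rm lex}$ is a shelling of $\hat{{}^2\Pi}_n$; (b) if $x,y,y',z\in{}^2\Pi_n$ satisfy $x\lessdot y\lessdot z$, $x\lessdot y'$ and $y'\prec_x y$, then either there is $y''\in{}^2\Pi_n$ with $x\lessdot y''\lessdot z$ and $y''\prec_x y$, or there is $z'\in{}^2\Pi_n$ with $y\lessdot z'\le y'\vee z$ and $z'\prec_y z$. In particular $\hat{{}^2\Pi}_n$ is shellable. -/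

import Mathlib

/-! ### Noncrossing partitions -/

/-- A set partition of `{1, …, n}` (modelled on `Fin n`) is noncrossing if there are no
`i < j < k < l` with `i, k` in one block and `j, l` in a different block. -/
def IsNoncrossing {n : ℕ} (P : Finpartition (Finset.univ : Finset (Fin n))) : Prop :=
  ∀ i j k l : Fin n, i < j → j < k → k < l →
    ∀ B₁ ∈ P.parts, ∀ B₂ ∈ P.parts, i ∈ B₁ → k ∈ B₁ → j ∈ B₂ → l ∈ B₂ → B₁ = B₂

/-- The set `NC_n` of noncrossing partitions. -/
@[ext] structure NC (n : ℕ) where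
  part : Finpartition (Finset.univ : Finset (Fin n))
  noncrossing : IsNoncrossing part

namespace NC

variable {n : ℕ}

/-- `x ≤ y` when `y` refines `x`: the one-block partition is the minimum.  (In Mathlib,
`P ≤ Q` for `Finpartition`s means that `P` refines `Q`.) -/
instance : PartialOrder (NC n) where
  le x y := y.part ≤ x.part
  le_refl x := le_refl x.part
  le_trans _ _ _ h₁ h₂ := le_trans h₂ h₁
  le_antisymm _ _ h₁ h₂ := NC.ext (le_antisymm h₂ h₁)

theorem le_def {x y : NC n} : x ≤ y ↔ y.part ≤ x.part := Iff.rfl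

/-- The cycle on a block `{b₁ < … < b_k}` sending `b_i` to `b_{i+1}` and `b_k` to `b₁`. -/
def blockCycle (B : Finset (Fin n)) : Equiv.Perm (Fin n) := (B.sort (· ≤ ·)).formPerm

theorem blockCycle_mem_iff (B : Finset (Fin n)) (i : Fin n) : blockCycle B i ∈ B ↔ i ∈ B := by
  rw [← Finset.mem_sort (s := B) (· ≤ ·), ← Finset.mem_sort (s := B) (a := i) (· ≤ ·)]
  exact List.formPerm_mem_iff_mem

theorem part_blockCycle (P : Finpartition (Finset.univ : Finset (Fin n))) (i : Fin n) :
    P.part (blockCycle (P.part i) i) = P.part i := by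
  apply P.part_eq_of_mem (P.part_mem.2 (Finset.mem_univ i))
  exact (blockCycle_mem_iff _ _).2 (P.mem_part_self.2 (Finset.mem_univ i))

theorem part_blockCycle_symm (P : Finpartition (Finset.univ : Finset (Fin n))) (i : Fin n) :
    P.part ((blockCycle (P.part i)).symm i) = P.part i := by
  apply P.part_eq_of_mem (P.part_mem.2 (Finset.mem_univ i))
  rw [← blockCycle_mem_iff, Equiv.apply_symm_apply]
  exact P.mem_part_self.2 (Finset.mem_univ i)

/-- The permutation `x̄` attached to a noncrossing partition `x`: it has one cycle for each block,
running through the block in increasing order. -/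
def bar (x : NC n) : Equiv.Perm (Fin n) where
  toFun i := blockCycle (x.part.part i) i
  invFun i := (blockCycle (x.part.part i)).symm i
  left_inv i := by beta_reduce; rw [part_blockCycle]; simp
  right_inv i := by beta_reduce; rw [part_blockCycle_symm]; simp

/-- The label of a cover relation `x ⋖ y` of `NC_n`.  For such a cover relation `ȳ x̄⁻¹` is a
transposition `(i j)` with `i < j`, and the label is the pair `(i, j)`, that is, the least and the
greatest moved point.  Pairs are compared lexicographically.
Products of permutations are composed from right to left. -/
def label (x y : NC n) : WithTop (Fin n) ×ₗ WithBot (Fin n) :=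
  toLex ((y.bar * x.bar⁻¹).support.min, (y.bar * x.bar⁻¹).support.max)

end NC

/-! ### EL-labelings -/

section Labelings

variable {P Λ : Type*} [PartialOrder P]

/-- `c` is a saturated chain `x = c₀ ⋖ c₁ ⋖ … ⋖ c_m = y`, i.e. a maximal chain of `[x, y]`. -/
def IsSaturatedChain (x y : P) (c : List P) : Prop :=
  c.head? = some x ∧ c.getLast? = some y ∧ c.IsChain (· ⋖ ·)

/-- The word `lab c₀ c₁, lab c₁ c₂, …` of labels along a chain. -/
def labelWord (lab : P → P → Λ) (c : List P) : List Λ := List.zipWith lab c c.tail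

/-- An edge-labeling (only the values on cover relations matter) is an EL-labeling if in every
interval exactly one maximal chain has a strictly increasing word of labels, and that
word is lexicographically minimal among those of all maximal chains of the interval. -/
def IsELLabeling [LinearOrder Λ] (lab : P → P → Λ) : Prop :=
  ∀ x y : P, x ≤ y → ∃ c : List P, IsSaturatedChain x y c ∧ (labelWord lab c).IsChain (· < ·) ∧
    (∀ c', IsSaturatedChain x y c' → (labelWord lab c').IsChain (· < ·) → c' = c) ∧
    (∀ c', IsSaturatedChain x y c' → labelWord lab c ≤ labelWord lab c')

/-- Distinct upper covers of the same element have distinct labels. -/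
def IsInjectiveOnCovers (lab : P → P → Λ) : Prop :=
  ∀ x y y' : P, x ⋖ y → x ⋖ y' → lab x y = lab x y' → y = y'

end Labelings

/-! ### Noncrossing 2-partitions -/

/-- Noncrossing 2-partitions of `{1, …, n}`: triples `(π, ρ, lam)` with `π` a noncrossing
partition, `ρ` a set partition and `lam` a bijection from the blocks of `π` to those of `ρ` that
preserves the sizes of the blocks. -/
structure TwoPartition (n : ℕ) where
  π : NC n
  ρ : Finpartition (Finset.univ : Finset (Fin n))
  lam : {B // B ∈ π.part.parts} ≃ {C // C ∈ ρ.parts}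
  card_lam : ∀ B, (lam B).1.card = B.1.card

namespace TwoPartition

variable {n : ℕ}

/-- Edelman's order: `φ ≤ ψ` if the two partitions of `ψ` refine those of `φ` and, whenever a
block `B'` of `φ.π` is the union of blocks `B` of `ψ.π`, its image `φ.lam B'` is the union of the
images `ψ.lam B`. -/
def Le (φ ψ : TwoPartition n) : Prop :=
  ψ.π.part ≤ φ.π.part ∧ ψ.ρ ≤ φ.ρ ∧
    ∀ (S : Finset {B // B ∈ ψ.π.part.parts}) (B' : {B // B ∈ φ.π.part.parts}),
      S.biUnion (fun B => B.1) = B'.1 → S.biUnion (fun B => (ψ.lam B).1) = (φ.lam B').1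

theorem le_iff_exists (φ ψ : TwoPartition n) :
    φ.Le ψ ↔ ∀ B, ∃ B', B.1 ⊆ B'.1 ∧ (ψ.lam B).1 ⊆ (φ.lam B').1 := by
  classical
  constructor
  · rintro ⟨h₁, -, h₃⟩ B
    obtain ⟨C, hC, hBC⟩ := h₁ B.2
    refine ⟨⟨C, hC⟩, hBC, ?_⟩
    rw [← h₃ (Finset.univ.filter fun D => D.1 ⊆ C) ⟨C, hC⟩]
    · intro k hk
      exact Finset.mem_biUnion.2 ⟨B, by simpa using hBC, hk⟩
    · ext i
      simp only [Finset.mem_biUnion, Finset.mem_filter, Finset.mem_univ, true_and]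
      constructor
      · rintro ⟨D, hD, hi⟩
        exact hD hi
      · intro hi
        obtain ⟨D, hD, hiD⟩ := ψ.π.part.exists_mem (Finset.mem_univ i)
        obtain ⟨E, hE, hDE⟩ := h₁ hD
        have : E = C := φ.π.part.eq_of_mem_parts hE hC (hDE hiD) hi
        subst this
        exact ⟨⟨D, hD⟩, hDE, hiD⟩
  · intro h
    refine ⟨fun B hB => ?_, fun C hC => ?_, fun S B' hS => ?_⟩
    · obtain ⟨B', h₁, -⟩ := h ⟨B, hB⟩
      exact ⟨B'.1, B'.2, h₁⟩
    · obtain ⟨B', -, h₂⟩ := h (ψ.lam.symm ⟨C, hC⟩)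
      rw [Equiv.apply_symm_apply] at h₂
      exact ⟨_, (φ.lam B').2, h₂⟩
    · have hsub : S.biUnion (fun B => (ψ.lam B).1) ⊆ (φ.lam B').1 := by
        intro k hk
        obtain ⟨B, hB, hkB⟩ := Finset.mem_biUnion.1 hk
        obtain ⟨B'', h₁, h₂⟩ := h B
        obtain ⟨i, hi⟩ := ψ.π.part.nonempty_of_mem_parts B.2
        have hi' : i ∈ B'.1 := hS ▸ Finset.mem_biUnion.2 ⟨B, hB, hi⟩
        have : B'' = B' := Subtype.ext (φ.π.part.eq_of_mem_parts B''.2 B'.2 (h₁ hi) hi')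
        exact this ▸ h₂ hkB
      refine Finset.eq_of_subset_of_card_le hsub (le_of_eq ?_)
      rw [φ.card_lam, ← hS, Finset.card_biUnion, Finset.card_biUnion]
      · exact (Finset.sum_congr rfl fun B _ => ψ.card_lam B).symm
      · intro B _ C _ hBC
        exact ψ.ρ.disjoint (ψ.lam B).2 (ψ.lam C).2
          fun h => hBC (ψ.lam.injective (Subtype.ext h))
      · intro B _ C _ hBC
        exact ψ.π.part.disjoint B.2 C.2 fun h => hBC (Subtype.ext h)

theorem ext' {φ ψ : TwoPartition n} (h₁ : φ.π = ψ.π)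
    (h₂ : ∀ (B : Finset (Fin n)) (hB : B ∈ φ.π.part.parts) (hB' : B ∈ ψ.π.part.parts),
      (φ.lam ⟨B, hB⟩).1 = (ψ.lam ⟨B, hB'⟩).1) : φ = ψ := by
  obtain ⟨π, ρ, lam, c⟩ := φ
  obtain ⟨π', ρ', lam', c'⟩ := ψ
  dsimp only at h₁ h₂
  subst h₁
  have hρ : ρ = ρ' := by
    apply Finpartition.ext
    ext C
    constructor
    · intro hC
      have h := h₂ _ (lam.symm ⟨C, hC⟩).2 (lam.symm ⟨C, hC⟩).2
      rw [Subtype.coe_eta, Equiv.apply_symm_apply] at h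
      dsimp only at h
      rw [h]
      exact (lam' _).2
    · intro hC
      have h := h₂ _ (lam'.symm ⟨C, hC⟩).2 (lam'.symm ⟨C, hC⟩).2
      rw [Subtype.coe_eta, Equiv.apply_symm_apply] at h
      dsimp only at h
      rw [← h]
      exact (lam _).2
  subst hρ
  have hl : lam = lam' := Equiv.ext fun B => Subtype.ext (h₂ B.1 B.2 B.2)
  subst hl
  rfl

instance : PartialOrder (TwoPartition n) where
  le := Le
  le_refl φ := (le_iff_exists φ φ).2 fun B => ⟨B, subset_rfl, subset_rfl⟩
  le_trans φ ψ χ h₁ h₂ := by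
    rw [le_iff_exists] at h₁ h₂ ⊢
    intro B
    obtain ⟨C, hC, hC'⟩ := h₂ B
    obtain ⟨D, hD, hD'⟩ := h₁ C
    exact ⟨D, hC.trans hD, hC'.trans hD'⟩
  le_antisymm φ ψ h₁ h₂ := by
    have hπ : φ.π = ψ.π := NC.ext (le_antisymm h₂.1 h₁.1)
    rw [le_iff_exists] at h₁ h₂
    refine ext' hπ fun B hB hB' => ?_
    apply subset_antisymm
    · obtain ⟨C, hC, hC'⟩ := h₂ ⟨B, hB⟩
      obtain ⟨i, hi⟩ := φ.π.part.nonempty_of_mem_parts hB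
      have : C = ⟨B, hB'⟩ := Subtype.ext (ψ.π.part.eq_of_mem_parts C.2 hB' (hC hi) hi)
      exact this ▸ hC'
    · obtain ⟨C, hC, hC'⟩ := h₁ ⟨B, hB'⟩
      obtain ⟨i, hi⟩ := φ.π.part.nonempty_of_mem_parts hB
      have : C = ⟨B, hB⟩ := Subtype.ext (φ.π.part.eq_of_mem_parts C.2 hB (hC hi) hi)
      exact this ▸ hC'

theorem le_def {φ ψ : TwoPartition n} : φ ≤ ψ ↔ φ.Le ψ := Iff.rfl

theorem mem_top_parts {B : Finset (Fin n)}
    (hB : B ∈ (⊤ : Finpartition (Finset.univ : Finset (Fin n))).parts) : B = Finset.univ :=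
  Finset.mem_singleton.1 (Finpartition.parts_top_subset _ hB)

/-- The minimum is `(0_n, 0_n, id)`, where `0_n` is the partition with a single block. -/
instance : OrderBot (TwoPartition n) where
  bot :=
    { π := ⟨⊤, fun _ _ _ _ _ _ _ _ h₁ _ h₂ _ _ _ _ =>
        (mem_top_parts h₁).trans (mem_top_parts h₂).symm⟩
      ρ := ⊤
      lam := Equiv.refl _
      card_lam := fun _ => rfl }
  bot_le φ := by
    rw [le_def, le_iff_exists]
    intro B
    obtain ⟨i, -⟩ := φ.π.part.nonempty_of_mem_parts B.2
    obtain ⟨U, hU, -⟩ :=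
      (⊤ : Finpartition (Finset.univ : Finset (Fin n))).exists_mem (Finset.mem_univ i)
    have hU' := mem_top_parts hU
    subst hU'
    exact ⟨⟨Finset.univ, hU⟩, Finset.subset_univ _, Finset.subset_univ _⟩

/-- The increasing bijection from a block `B` of `π` onto the block `lam B`. -/
def blockIso (φ : TwoPartition n) (B : {B // B ∈ φ.π.part.parts}) : B.1 ≃o (φ.lam B).1 :=
  (B.1.orderIsoOfFin rfl).symm.trans ((φ.lam B).1.orderIsoOfFin (φ.card_lam B))

/-- The block of `π` containing `i`. -/
def block (φ : TwoPartition n) (i : Fin n) : {B // B ∈ φ.π.part.parts} :=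
  ⟨φ.π.part.part i, φ.π.part.part_mem.2 (Finset.mem_univ i)⟩

theorem mem_block (φ : TwoPartition n) (i : Fin n) : i ∈ (φ.block i).1 :=
  φ.π.part.mem_part_self.2 (Finset.mem_univ i)

theorem block_eq (φ : TwoPartition n) (B : {B // B ∈ φ.π.part.parts}) {i : Fin n} (hi : i ∈ B.1) :
    φ.block i = B :=
  Subtype.ext (φ.π.part.part_eq_of_mem B.2 hi)

/-- The underlying function of `TwoPartition.perm`. -/
def permFun (φ : TwoPartition n) (i : Fin n) : Fin n :=
  (φ.blockIso (φ.block i) ⟨i, φ.mem_block i⟩).1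

theorem permFun_eq (φ : TwoPartition n) (B : {B // B ∈ φ.π.part.parts}) {i : Fin n}
    (hi : i ∈ B.1) : φ.permFun i = (φ.blockIso B ⟨i, hi⟩).1 := by
  obtain rfl := φ.block_eq B hi
  rfl

theorem permFun_injective (φ : TwoPartition n) : Function.Injective φ.permFun := by
  intro i j hij
  have hi : φ.permFun i ∈ (φ.lam (φ.block i)).1 := (φ.blockIso _ _).2
  have hj : φ.permFun i ∈ (φ.lam (φ.block j)).1 := hij ▸ (φ.blockIso _ _).2
  have hB : φ.block j = φ.block i := φ.lam.injective
    (Subtype.ext (φ.ρ.eq_of_mem_parts (φ.lam _).2 (φ.lam _).2 hj hi))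
  have hmem : j ∈ (φ.block i).1 := hB ▸ φ.mem_block j
  rw [φ.permFun_eq (φ.block i) (φ.mem_block i), φ.permFun_eq (φ.block i) hmem] at hij
  exact congrArg Subtype.val ((φ.blockIso _).injective (Subtype.ext hij))

/-- The permutation `σ` in the representation of a noncrossing 2-partition as a pair `(π, σ)`: the
unique permutation that maps every block `B` of `π` increasingly onto `lam B`. -/
noncomputable def perm (φ : TwoPartition n) : Equiv.Perm (Fin n) :=
  Equiv.ofBijective φ.permFun (Finite.injective_iff_bijective.1 φ.permFun_injective)

theorem perm_strictMonoOn (φ : TwoPartition n) (B : {B // B ∈ φ.π.part.parts}) :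
    StrictMonoOn φ.perm (B.1 : Set (Fin n)) := by
  intro i hi j hj hij
  change φ.permFun i < φ.permFun j
  rw [φ.permFun_eq B hi, φ.permFun_eq B hj]
  exact (φ.blockIso B).strictMono (a := ⟨i, hi⟩) (b := ⟨j, hj⟩) hij

theorem perm_image (φ : TwoPartition n) (B : {B // B ∈ φ.π.part.parts}) :
    B.1.image φ.perm = (φ.lam B).1 := by
  apply Finset.eq_of_subset_of_card_le
  · intro k hk
    obtain ⟨i, hi, rfl⟩ := Finset.mem_image.1 hk
    change φ.permFun i ∈ _
    rw [φ.permFun_eq B hi]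
    exact (φ.blockIso B _).2
  · rw [φ.card_lam, Finset.card_image_of_injective _ φ.perm.injective]

end TwoPartition

/-! ### The code of a permutation and the orders on upper covers -/

/-- `c_i(σ)`: the number of `j < i` with `σ⁻¹(j) > σ⁻¹(i)`. -/
def codeEntry {n : ℕ} (σ : Equiv.Perm (Fin n)) (i : Fin n) : ℕ :=
  (Finset.univ.filter fun j : Fin n => j < i ∧ σ.symm i < σ.symm j).card

/-- The code of `σ`: the word `c_n(σ) … c_1(σ)`, words being compared lexicographically. -/
def code {n : ℕ} (σ : Equiv.Perm (Fin n)) : Lex (Fin n → ℕ) :=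
  toLex fun k => codeEntry σ (Fin.rev k)

/-- The poset of noncrossing 2-partitions with a new maximum `⊤` added. -/
abbrev HatTwoPartition (n : ℕ) : Type := WithTop (TwoPartition n)

/-- The order `≺_φ` on the noncrossing 2-partitions covering `φ`: upper covers are compared first
by their codes, then by the labels of the cover relations between the noncrossing partitions. -/
def TwoPartition.Prec {n : ℕ} {Λ : Type*} [LinearOrder Λ] (lab : NC n → NC n → Λ)
    (φ ψ ψ' : TwoPartition n) : Prop :=
  code ψ.perm < code ψ'.perm ∨
    code ψ.perm = code ψ'.perm ∧ lab φ.π ψ.π < lab φ.π ψ'.π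

/-- The orders `≺_x` on upper covers in the poset with `⊤` added.  An element of rank `n - 1` has
`⊤` as its only upper cover, so there is nothing to compare. -/
def HatTwoPartition.Prec {n : ℕ} {Λ : Type*} [LinearOrder Λ] (lab : NC n → NC n → Λ)
    (x y y' : HatTwoPartition n) : Prop :=
  ∃ φ ψ ψ' : TwoPartition n, x = φ ∧ y = ψ ∧ y' = ψ' ∧ TwoPartition.Prec lab φ ψ ψ'

/-! ### Maximal chains, lexicographic orders and shellings -/

section Shelling

/-- The set of upper covers of `x`. -/
abbrev UpperCovers {P : Type*} [PartialOrder P] (x : P) : Type _ := {y : P // x ⋖ y}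

/-- `P` is ranked of length `m`: all its maximal chains have `m + 1` elements. -/
def IsRankedOfLength (P : Type*) [PartialOrder P] (m : ℕ) : Prop :=
  ∀ F : Flag P, (F : Set P).ncard = m + 1

/-- Maximal chains `⊥ = p₀ ⋖ p₁ ⋖ … ⋖ p_m = ⊤` of a bounded poset that is ranked of length `m`. -/
structure MaximalChain (P : Type*) [PartialOrder P] [BoundedOrder P] (m : ℕ) where
  elem : Fin (m + 1) → P
  elem_zero : elem 0 = ⊥
  elem_last : elem (Fin.last m) = ⊤
  covBy : ∀ i : Fin m, elem i.castSucc ⋖ elem i.succ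

variable {P : Type*} [PartialOrder P] [BoundedOrder P]

/-- The set of elements of a maximal chain. -/
def MaximalChain.toSet {m : ℕ} (p : MaximalChain P m) : Set P := Set.range p.elem

/-- The lexicographic order on maximal chains induced by a family of orders on upper covers:
`p'` precedes `p` if `p'_{j+1}` precedes `p_{j+1}` as an upper cover of `p_j`, where `j` is
minimal with `p'_{j+1} ≠ p_{j+1}`. -/
def LexLT {m : ℕ} (prec : P → P → P → Prop) (p' p : MaximalChain P m) : Prop :=
  ∃ j : Fin m, (∀ i < j, p'.elem i.succ = p.elem i.succ) ∧ p'.elem j.succ ≠ p.elem j.succ ∧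
    prec (p.elem j.castSucc) (p'.elem j.succ) (p.elem j.succ)

/-- A shelling of a bounded poset that is ranked of length `m`: a total order on its maximal chains
such that, whenever `p'` comes before `p`, there is a maximal chain `p''` before `p`
that shares all but one of the `m + 1` elements of `p` and contains `p' ∩ p`. -/
structure IsShelling {m : ℕ} (lt : MaximalChain P m → MaximalChain P m → Prop) : Prop where
  strictTotal : IsStrictTotalOrder (MaximalChain P m) lt
  exchange : ∀ p' p, lt p' p → ∃ p'', lt p'' p ∧ (p''.toSet ∩ p.toSet).ncard = m ∧
    p'.toSet ∩ p.toSet ⊆ p''.toSet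

end Shelling

/-! In `NC n` the upper covers of `x` are the cuts `x.cut i j` with `i < j` in one block `A`: they
split off `A ∩ [i, j)` and multiply `x.bar` on the left by the transposition `(i j)`. Hence the
number of blocks is a rank function and the labels `(i, j)` are injective on covers. The EL property
reduces to a comparison of atoms (`isELLabeling_of_atoms`): in each interval the atom with the least
label is the only one that can start an increasing chain.

For 2-partitions, let `pos v` be the position of the value `v` in the permutation. Then `φ ≤ ψ`
means that `ψ.π` refines `φ.π` and every value stays in its block of `φ.π` (`le_iff_pos`). Comparing
codes means looking at the greatest value whose positions differ: the larger code has it further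
left (`code_lt_iff`). Since the permutation increases on blocks, `φ.pos v` is the greatest position
of its block not taken by a greater value (`le_pos_of_eqOn`). So the code weakly increases along the
order (`code_mono`), and if the two ends of a code-ordered triple agree on the large values, so does
the middle (`eqOn_of_code_le_of_code_le`).

The core is the local exchange property for `x ⋖ y ⋖ z` and `y' ≺ y`. If `y'` and `z` have an upper
bound, there are three situations. When no value moves, the claim concerns `NC n` alone and follows
from the EL property (`IsELLabeling.le_of_forall_le`). When the greatest value moved in `x ⋖ y`
rests in `y ⋖ z`, merging two blocks of `z` gives `y''` (`exists_code_lt_of_eqOn_Ici`). Otherwise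
let `d` be the greatest value moved in `y ⋖ z`: if `y` and `y'` agree on the values from `d` on,
their join supplies `z'`; if not, `d` may be the greatest value moved in both steps, and a planarity
argument with three candidate merges decides (`exists_exchange_of_pos_lt`). Without an upper bound
the join is `⊤`, and keeping the permutation of `y` or of `z` suffices.

The local property gives the shelling: where `p'` leaves `p`, either an exchange of one element of
`p` is possible at once, or the discrepancy moves one step up along `p`, into a shorter interval
(`exists_exchange_between`). -/

namespace NC

/-! ### Noncrossing partitions as equivalence relations -/

variable {n : ℕ}

/-- `i` and `j` lie in the same block. -/
def Rel (x : NC n) (i j : Fin n) : Prop := x.part.part i = x.part.part j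

theorem Rel.refl (x : NC n) (i : Fin n) : x.Rel i i := rfl

theorem Rel.symm {x : NC n} {i j : Fin n} (h : x.Rel i j) : x.Rel j i := Eq.symm h

theorem Rel.trans {x : NC n} {i j k : Fin n} (h : x.Rel i j) (h' : x.Rel j k) : x.Rel i k :=
  Eq.trans h h'

theorem mem_part_iff {x : NC n} {i j : Fin n} : i ∈ x.part.part j ↔ x.Rel i j :=
  x.part.mem_part_iff_part_eq_part (Finset.mem_univ i) (Finset.mem_univ j)

theorem part_mem_parts (x : NC n) (i : Fin n) : x.part.part i ∈ x.part.parts :=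
  x.part.part_mem.2 (Finset.mem_univ i)

theorem Rel.noncrossing {x : NC n} {i j k l : Fin n} (hik : x.Rel i k) (hjl : x.Rel j l)
    (hij : i ≤ j) (hjk : j ≤ k) (hkl : k ≤ l) : x.Rel i j := by
  rcases hij.eq_or_lt with rfl | hij
  · exact Rel.refl x i
  rcases hjk.eq_or_lt with rfl | hjk
  · exact hik
  rcases hkl.eq_or_lt with rfl | hkl
  · exact hik.trans hjl.symm
  exact x.noncrossing i j k l hij hjk hkl _ (x.part_mem_parts i) _ (x.part_mem_parts j)
    (mem_part_iff.2 (Rel.refl x i)) (mem_part_iff.2 hik.symm) (mem_part_iff.2 (Rel.refl x j))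
    (mem_part_iff.2 hjl.symm)

theorem le_iff_rel {x y : NC n} : x ≤ y ↔ ∀ i j, y.Rel i j → x.Rel i j := by
  constructor
  · intro h i j hij
    obtain ⟨C, hC, hBC⟩ := h (y.part_mem_parts i)
    have h1 := hBC (mem_part_iff.2 (Rel.refl y i))
    have h2 := hBC (mem_part_iff.2 hij.symm)
    exact (x.part.part_eq_of_mem hC h1).trans (x.part.part_eq_of_mem hC h2).symm
  · intro h B hB
    obtain ⟨i, hi⟩ := y.part.nonempty_of_mem_parts hB
    refine ⟨_, x.part_mem_parts i, fun j hj => mem_part_iff.2 (h _ _ ?_)⟩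
    exact (y.part.part_eq_of_mem hB hj).trans (y.part.part_eq_of_mem hB hi).symm

theorem Rel.mono {x y : NC n} (h : x ≤ y) {i j : Fin n} (hij : y.Rel i j) : x.Rel i j :=
  le_iff_rel.1 h i j hij

theorem exists_rel_not_rel {x y : NC n} (h : x < y) : ∃ i j, x.Rel i j ∧ ¬ y.Rel i j := by
  by_contra! hc
  exact h.not_ge (le_iff_rel.2 hc)

open Classical in
/-- The noncrossing partition given by a noncrossing equivalence relation. -/
noncomputable def ofSetoid (s : Setoid (Fin n))
    (h : ∀ i j k l, i < j → j < k → k < l → s i k → s j l → s i j) : NC n where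
  part := Finpartition.ofSetoid s
  noncrossing i j k l hij hjk hkl B hB C hC hi hk hj hl := by
    have hB' := (Finpartition.ofSetoid s).part_eq_of_mem hB hi
    have hC' := (Finpartition.ofSetoid s).part_eq_of_mem hC hj
    rw [← hB', Finpartition.mem_part_ofSetoid_iff_rel] at hk
    rw [← hC', Finpartition.mem_part_ofSetoid_iff_rel] at hl
    have := h i j k l hij hjk hkl hk hl
    rw [← Finpartition.mem_part_ofSetoid_iff_rel, hB'] at this
    exact Finpartition.eq_of_mem_parts _ hB hC this hj

theorem ofSetoid_rel {s : Setoid (Fin n)}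
    {h : ∀ i j k l, i < j → j < k → k < l → s i k → s j l → s i j} {i j : Fin n} :
    (ofSetoid s h).Rel i j ↔ s i j := by
  classical
  rw [← mem_part_iff]
  refine (Finpartition.mem_part_ofSetoid_iff_rel).trans ⟨s.symm, s.symm⟩

instance : Finite (NC n) :=
  Finite.of_injective NC.part fun _ _ h => NC.ext h

/-! ### Cutting a block in two -/

/-- The partition obtained from `x` by splitting the block `A` of `i` into `A ∩ [i, j)` and its
complement in `A`. -/
noncomputable def cut (x : NC n) (i j : Fin n) : NC n :=
  ofSetoid
    { r := fun a b => x.Rel a b ∧ (x.Rel a i → ((i ≤ a ∧ a < j) ↔ (i ≤ b ∧ b < j)))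
      iseqv :=
        { refl := fun a => ⟨Rel.refl x a, fun _ => Iff.rfl⟩
          symm := fun h => ⟨h.1.symm, fun hb => (h.2 (h.1.trans hb)).symm⟩
          trans := fun h h' => ⟨h.1.trans h'.1, fun ha =>
            (h.2 ha).trans (h'.2 (h.1.symm.trans ha))⟩ } }
    (by
      rintro a b c d hab hbc hcd ⟨h1, h1'⟩ ⟨h2, h2'⟩
      have h := h1.noncrossing h2 hab.le hbc.le hcd.le
      -- All four points lie in one block of `x`. Neither an interval nor its complement can be met
      -- by `a`, `c` only or by `b`, `d` only in a way that separates `a` from `b`, since `b` lies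
      -- between `a` and `c`, and `c` between `b` and `d`.
      refine ⟨h, fun ha => ?_⟩
      have h1' := h1' ha
      have h2' := h2' (h.symm.trans ha)
      constructor <;> intro h3 <;> constructor <;> by_contra h4 <;> omega)

theorem cut_rel {x : NC n} {i j a b : Fin n} : (x.cut i j).Rel a b ↔
    x.Rel a b ∧ (x.Rel a i → ((i ≤ a ∧ a < j) ↔ (i ≤ b ∧ b < j))) :=
  ofSetoid_rel

theorem le_cut (x : NC n) (i j : Fin n) : x ≤ x.cut i j :=
  le_iff_rel.2 fun _ _ h => (cut_rel.1 h).1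

theorem cut_le_iff {x y : NC n} (h : x ≤ y) {i j : Fin n} : x.cut i j ≤ y ↔
    ∀ a b, y.Rel a b → x.Rel a i → i ≤ a → a < j → (i ≤ b ∧ b < j) := by
  rw [le_iff_rel]
  constructor
  · intro h1 a b hab hai h2 h3
    exact ((cut_rel.1 (h1 a b hab)).2 hai).1 ⟨h2, h3⟩
  · intro h1 a b hab
    refine cut_rel.2 ⟨hab.mono h, fun ha => ⟨fun h2 => h1 a b hab ha h2.1 h2.2, fun h2 => ?_⟩⟩
    exact h1 b a hab.symm ((hab.mono h).symm.trans ha) h2.1 h2.2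

theorem not_cut_rel {x : NC n} {i j : Fin n} (hij : i < j) : ¬ (x.cut i j).Rel i j := fun h =>
  absurd (((cut_rel.1 h).2 (Rel.refl x i)).1 ⟨le_rfl, hij⟩).2 (lt_irrefl j)

theorem lt_cut {x : NC n} {i j : Fin n} (hij : i < j) (h : x.Rel i j) : x < x.cut i j :=
  lt_of_le_not_ge (x.le_cut i j) fun h' => not_cut_rel hij (h.mono h')

theorem _root_.iff_of_not_iff {a b c : Prop} (h : ¬ (a ↔ b)) (h' : ¬ (a ↔ c)) : b ↔ c := by
  tauto

/-- The cut leaves only two pieces of the block of `i`. An intermediate partition keeps each piece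
together, so a single link across the cut joins the whole block again. -/
theorem covBy_cut {x : NC n} {i j : Fin n} (hij : i < j) (h : x.Rel i j) : x ⋖ x.cut i j := by
  refine ⟨lt_cut hij h, fun w hxw hwy => ?_⟩
  obtain ⟨a, b, hab, hab'⟩ := exists_rel_not_rel hxw
  obtain ⟨c, d, hcd, hcd'⟩ := exists_rel_not_rel hwy
  rw [cut_rel] at hcd'
  have key : ∀ a b, x.Rel a b → ¬ w.Rel a b →
      x.Rel a i ∧ ¬ ((i ≤ a ∧ a < j) ↔ (i ≤ b ∧ b < j)) := by
    intro a b hab hab'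
    by_contra hc
    refine hab' (Rel.mono hwy.le (cut_rel.2 ⟨hab, fun ha => ?_⟩))
    by_contra h'
    exact hc ⟨ha, h'⟩
  obtain ⟨hai, h1⟩ := key a b hab hab'
  have h2 : x.Rel c i ∧ ¬ ((i ≤ c ∧ c < j) ↔ (i ≤ d ∧ d < j)) := by
    by_contra hc
    refine hcd' ⟨hcd.mono hxw.le, fun ha => ?_⟩
    by_contra h'
    exact hc ⟨ha, h'⟩
  have h3 : ∀ e f, x.Rel e i → x.Rel f i → ((i ≤ e ∧ e < j) ↔ (i ≤ f ∧ f < j)) → w.Rel e f :=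
    fun e f he hf h => Rel.mono hwy.le (cut_rel.2 ⟨he.trans hf.symm, fun _ => h⟩)
  have hbi := hab.symm.trans hai
  have hdi := (hcd.mono hxw.le).symm.trans h2.1
  by_cases h4 : ((i ≤ a ∧ a < j) ↔ (i ≤ c ∧ c < j))
  · exact hab' (((h3 a c hai h2.1 h4).trans hcd).trans (h3 d b hdi hbi
      (iff_of_not_iff h2.2 fun h => h1 (h4.trans h))))
  · exact hab' (((h3 a d hai hdi (iff_of_not_iff (fun h => h4 h.symm) h2.2)).trans
      hcd.symm).trans (h3 c b h2.1 hbi (iff_of_not_iff h4 h1)))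

theorem _root_.exists_isLeast_fin {S : Set (Fin n)} (hS : S.Nonempty) : ∃ m, IsLeast S m := by
  obtain ⟨m, hm, h⟩ := Set.exists_min_image S id (Set.toFinite S) hS
  exact ⟨m, hm, fun a ha => h a ha⟩

/-- In a block of `x` broken by `y`, let `m` be the least element and `i` the least one outside the
`y`-block of `m`. If that `y`-block returns after `i`, first at `j`, planarity encloses all blocks
meeting `[i, j)`. If it never returns, it is exactly the part of the block in `[m, i)`. -/
theorem exists_cut_le {x y : NC n} (h : x < y) :
    ∃ i j, i < j ∧ x.Rel i j ∧ x.cut i j ≤ y := by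
  obtain ⟨a, b, hab, hab'⟩ := exists_rel_not_rel h
  obtain ⟨m, hm⟩ : ∃ m, IsLeast {c | x.Rel c a} m :=
    exists_isLeast_fin ⟨a, Rel.refl x a⟩
  obtain ⟨i, hi⟩ : ∃ i, IsLeast {c | x.Rel c a ∧ ¬ y.Rel m c} i := by
    refine exists_isLeast_fin ?_
    by_cases hma : y.Rel m a
    · exact ⟨b, hab.symm, fun hmb => hab' (hma.symm.trans hmb)⟩
    · exact ⟨a, Rel.refl x a, hma⟩
  have hmi : m < i := lt_of_le_of_ne (hm.2 hi.1.1) fun e => hi.1.2 (e ▸ Rel.refl y m)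
  have hlt : ∀ c, x.Rel c a → c < i → y.Rel m c := fun c hc hci => by
    by_contra h'
    exact (hi.2 ⟨hc, h'⟩).not_gt hci
  by_cases hS : ({c | x.Rel c a ∧ y.Rel m c ∧ i < c} : Set (Fin n)).Nonempty
  · obtain ⟨j, hj⟩ := exists_isLeast_fin hS
    refine ⟨i, j, hj.1.2.2, hi.1.1.trans hj.1.1.symm,
      (cut_le_iff h.le).2 fun c d hcd hci hic hcj => ?_⟩
    have hca := hci.trans hi.1.1
    have hda := (hcd.mono h.le).symm.trans hca
    have hmc : ¬ y.Rel m c := fun h' => by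
      rcases hic.eq_or_lt with rfl | hic
      · exact hi.1.2 h'
      · exact (hj.2 ⟨hca, h', hic⟩).not_gt hcj
    constructor
    · by_contra! hd
      exact hmc ((hlt d hda hd).trans hcd.symm)
    · by_contra! hd
      exact hmc (hj.1.2.1.noncrossing hcd (hm.2 hca) hcj.le hd)
  · refine ⟨m, i, hmi, hm.1.trans hi.1.1.symm, (cut_le_iff h.le).2 fun c d hcd hcm hmc hci => ?_⟩
    have hca := hcm.trans hm.1
    have hda := (hcd.mono h.le).symm.trans hca
    have hmd : y.Rel m d := (hlt c hca hci).trans hcd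
    refine ⟨hm.2 hda, ?_⟩
    by_contra! hd
    refine hS ⟨d, hda, hmd, lt_of_le_of_ne hd ?_⟩
    rintro rfl
    exact hi.1.2 hmd

theorem covBy_iff_exists_cut {x y : NC n} :
    x ⋖ y ↔ ∃ i j, i < j ∧ x.Rel i j ∧ y = x.cut i j := by
  constructor
  · intro h
    obtain ⟨i, j, hij, hr, hle⟩ := exists_cut_le h.lt
    refine ⟨i, j, hij, hr, ?_⟩
    by_contra hne
    exact h.2 (lt_cut hij hr) (lt_of_le_of_ne hle (Ne.symm hne))
  · rintro ⟨i, j, hij, hr, rfl⟩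
    exact covBy_cut hij hr

/-! ### The rank -/

/-- The set of least elements of blocks. -/
def minima (x : NC n) : Set (Fin n) := {a | ∀ b < a, ¬ x.Rel b a}

/-- The number of blocks. -/
noncomputable def rank (x : NC n) : ℕ := x.minima.ncard

/-- The piece with the old minimum keeps it. The new minimum is `j` if `i` was the minimum of its
block, and `i` otherwise. -/
theorem minima_cut {x : NC n} {i j : Fin n} (hij : i < j) (hr : x.Rel i j) :
    ∃ m, m ∉ x.minima ∧ (x.cut i j).minima = insert m x.minima := by
  by_cases hi : i ∈ x.minima
  · refine ⟨j, fun h => h i hij hr, Set.ext fun a => ⟨fun ha => ?_, ?_⟩⟩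
    · by_cases haj : a = j
      · exact Or.inl haj
      refine Or.inr fun b hb hba => ?_
      by_cases hai : x.Rel a i
      · rcases lt_trichotomy a i with h1 | rfl | h1
        · exact hi a h1 hai
        · exact hi b hb hba
        · by_cases h2 : a < j
          · exact ha i h1 (cut_rel.2 ⟨hai.symm, fun _ => by simp [h1.le, h2, hij]⟩)
          · exact ha j (lt_of_le_of_ne (not_lt.1 h2) (Ne.symm haj))
              (cut_rel.2 ⟨hr.symm.trans hai.symm, fun _ => by simp [h2]⟩)
      · exact ha b hb (cut_rel.2 ⟨hba, fun h => absurd (hba.symm.trans h) hai⟩)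
    · rintro (rfl | ha)
      · intro b hb hba
        obtain ⟨h1, h2⟩ := cut_rel.1 hba
        have h3 := h2 (h1.trans hr.symm)
        have h4 : ¬ b < i := fun h4 => hi b h4 (h1.trans hr.symm)
        exact absurd (h3.1 ⟨not_lt.1 h4, hb⟩).2 (lt_irrefl _)
      · exact fun b hb hba => ha b hb (cut_rel.1 hba).1
  · refine ⟨i, hi, Set.ext fun a => ⟨fun ha => ?_, ?_⟩⟩
    · by_cases hai : a = i
      · exact Or.inl hai
      refine Or.inr fun b hb hba => ?_
      by_cases hai' : x.Rel a i
      · have hi' : ∃ c < i, x.Rel c i := by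
          by_contra! h
          exact hi h
        obtain ⟨c, hci, hc⟩ := hi'
        rcases lt_or_gt_of_ne hai with h1 | h1
        · exact ha b hb (cut_rel.2 ⟨hba, fun _ => by simp [(hb.trans h1).not_ge, h1.not_ge]⟩)
        · by_cases h2 : a < j
          · exact ha i h1 (cut_rel.2 ⟨hai'.symm, fun _ => by simp [h1.le, h2, hij]⟩)
          · exact ha c (hci.trans h1) (cut_rel.2 ⟨hc.trans hai'.symm, fun _ => by simp [h2, hci]⟩)
      · exact ha b hb (cut_rel.2 ⟨hba, fun h => absurd (hba.symm.trans h) hai'⟩)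
    · rintro (rfl | ha)
      · intro b hb hba
        obtain ⟨h1, h2⟩ := cut_rel.1 hba
        exact hb.not_ge ((h2 h1).2 ⟨le_rfl, hij⟩).1
      · exact fun b hb hba => ha b hb (cut_rel.1 hba).1

theorem rank_of_covBy {x y : NC n} (h : x ⋖ y) : y.rank = x.rank + 1 := by
  obtain ⟨i, j, hij, hr, rfl⟩ := covBy_iff_exists_cut.1 h
  obtain ⟨m, hm, he⟩ := minima_cut hij hr
  rw [rank, he, Set.ncard_insert_of_notMem hm (Set.toFinite _), rank]

theorem exists_covBy_le {x y : NC n} (h : x < y) : ∃ w, x ⋖ w ∧ w ≤ y := by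
  obtain ⟨i, j, hij, hr, hle⟩ := exists_cut_le h
  exact ⟨_, covBy_cut hij hr, hle⟩

theorem rank_strictMono : StrictMono (rank (n := n)) := by
  intro x y h
  induction x using WellFoundedGT.induction with
  | _ x ih =>
    obtain ⟨w, hxw, hwy⟩ := exists_covBy_le h
    have h1 := rank_of_covBy hxw
    rcases hwy.eq_or_lt with rfl | hwy
    · omega
    · have := ih w hxw.lt hwy
      omega

theorem covBy_of_rank {x y : NC n} (h : x ≤ y) (hr : y.rank = x.rank + 1) : x ⋖ y := by
  refine ⟨lt_of_le_of_ne h (by rintro rfl; omega), fun w h1 h2 => ?_⟩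
  have h3 := rank_strictMono h1
  have h4 := rank_strictMono h2
  omega

/-! ### Merging blocks -/

/-- Merging all blocks of `y` that meet `I`, where `I` is a subset of a block of `x ≤ y` which
does not cross its complement in that block. -/
noncomputable def merge {x y : NC n} (hxy : x ≤ y) (I : Set (Fin n))
    (hI : ∀ a ∈ I, ∀ b ∈ I, x.Rel a b)
    (hI' : ∀ a b c d, x.Rel a b → x.Rel a c → a ∉ I → c ∉ I → b ∈ I → d ∈ I → a < b → b < c →
      a < d ∧ d < c) : NC n :=
  ofSetoid
    { r := fun a b => y.Rel a b ∨ (∃ c ∈ I, y.Rel a c) ∧ ∃ c ∈ I, y.Rel b c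
      iseqv :=
        { refl := fun a => Or.inl (Rel.refl y a)
          symm := fun h => h.imp Rel.symm And.symm
          trans := by
            rintro a b c (h | ⟨h, h'⟩) (k | ⟨⟨d, hd, k⟩, k'⟩)
            · exact Or.inl (h.trans k)
            · exact Or.inr ⟨⟨d, hd, h.trans k⟩, k'⟩
            · obtain ⟨e, he, h'⟩ := h'
              exact Or.inr ⟨h, e, he, k.symm.trans h'⟩
            · exact Or.inr ⟨h, k'⟩ } }
    (by
      -- The case where only `b` and `d` belong to the merged block. The representative `e` of `b`
      -- in `I` lies between `a` and `c` by planarity of `y`; then `hI'` puts the representative `f`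
      -- of `d` there as well, and `a < f < c < d` is a crossing. The opposite mixed case below is
      -- its mirror image.
      have key : ∀ a b c d, a < b → b < c → c < d → y.Rel a c →
          (∃ e ∈ I, y.Rel b e) → (∃ e ∈ I, y.Rel d e) → y.Rel a b ∨ (∃ e ∈ I, y.Rel a e) := by
        rintro a b c d hab hbc hcd hac ⟨e, he, hbe⟩ ⟨f, hf, hdf⟩
        by_contra! hcon
        have hxab : x.Rel a b := (hac.mono hxy).noncrossing
          (((hbe.mono hxy).trans (hI e he f hf)).trans (hdf.mono hxy).symm) hab.le hbc.le hcd.le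
        have haI : a ∉ I := fun h => hcon.2 a h (Rel.refl y a)
        have hcI : c ∉ I := fun h => hcon.2 c h hac
        have hae : a < e := by
          by_contra! h
          exact hcon.1 ((hbe.symm.noncrossing hac h hab.le hbc.le).symm.trans hbe.symm)
        have hec : e < c := by
          by_contra! h
          exact hcon.1 (hac.noncrossing hbe hab.le hbc.le h)
        obtain ⟨h1, h2⟩ := hI' a e c f (hxab.trans (hbe.mono hxy)) (hac.mono hxy) haI hcI he hf
          hae hec
        exact hcon.2 f hf (hac.noncrossing hdf.symm h1.le h2.le hcd.le)
      rintro a b c d hab hbc hcd (hac | ⟨⟨e, he, hae⟩, g, hg, hcg⟩)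
        (hbd | ⟨⟨f, hf, hbf⟩, k, hk, hdk⟩)
      · exact Or.inl (hac.noncrossing hbd hab.le hbc.le hcd.le)
      · exact (key a b c d hab hbc hcd hac ⟨f, hf, hbf⟩ ⟨k, hk, hdk⟩).imp id
          fun h => ⟨h, f, hf, hbf⟩
      · by_contra hcon
        have hb : ∀ e ∈ I, ¬ y.Rel b e := fun f hf hbf => hcon (Or.inr ⟨⟨e, he, hae⟩, f, hf, hbf⟩)
        have hab' : ¬ y.Rel a b := fun h => hcon (Or.inl h)
        have hcb' : ¬ y.Rel c b := fun h => hb g hg (h.symm.trans hcg)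
        have hxbc : x.Rel b c := (((hae.mono hxy).trans (hI e he g hg)).trans
          (hcg.mono hxy).symm).noncrossing (hbd.mono hxy) hab.le hbc.le hcd.le |>.symm.trans
          (((hae.mono hxy).trans (hI e he g hg)).trans (hcg.mono hxy).symm)
        have hbg : b < g := by
          by_contra! h
          exact hcb' ((hcg.trans (hcg.symm.noncrossing hbd h hbc.le hcd.le)))
        have hgd : g < d := by
          by_contra! h
          exact hcb' (hbd.noncrossing hcg hbc.le hcd.le h).symm
        obtain ⟨h1, h2⟩ := hI' b g d e (hxbc.trans (hcg.mono hxy)) (hbd.mono hxy)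
          (fun h => hb b h (Rel.refl y b)) (fun h => hb d h hbd) hg he hbg hgd
        exact hab' (hae.noncrossing hbd hab.le h1.le h2.le)
      · exact Or.inr ⟨⟨e, he, hae⟩, f, hf, hbf⟩)

end NC

namespace NC

variable {n : ℕ}

theorem merge_rel {x y : NC n} {hxy : x ≤ y} {I : Set (Fin n)} {hI hI'} {a b : Fin n} :
    (merge hxy I hI hI').Rel a b ↔ y.Rel a b ∨ (∃ c ∈ I, y.Rel a c) ∧ ∃ c ∈ I, y.Rel b c :=
  ofSetoid_rel

theorem merge_le {x y : NC n} {hxy : x ≤ y} {I : Set (Fin n)} {hI hI'} :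
    merge hxy I hI hI' ≤ y :=
  le_iff_rel.2 fun _ _ h => merge_rel.2 (Or.inl h)

theorem le_merge {x y : NC n} {hxy : x ≤ y} {I : Set (Fin n)} {hI hI'} :
    x ≤ merge hxy I hI hI' :=
  le_iff_rel.2 fun _ _ h => (merge_rel.1 h).elim (Rel.mono hxy) fun ⟨⟨c, hc, h⟩, d, hd, h'⟩ =>
    ((h.mono hxy).trans (hI c hc d hd)).trans (h'.mono hxy).symm

/-! ### The labeling by transpositions -/

theorem blockCycle_of_next {B : Finset (Fin n)} {i j : Fin n} (hi : i ∈ B) (hj : j ∈ B)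
    (hij : i < j) (h : ∀ k ∈ B, k ≤ i ∨ j ≤ k) : blockCycle B i = j := by
  have hs := B.sortedLT_sort
  obtain ⟨a, ha, rfl⟩ := List.getElem_of_mem ((B.mem_sort (· ≤ ·)).2 hi)
  obtain ⟨b, hb, rfl⟩ := List.getElem_of_mem ((B.mem_sort (· ≤ ·)).2 hj)
  have hab : a < b := hs.getElem_lt_getElem_iff.1 hij
  have ha' : a + 1 < (B.sort (· ≤ ·)).length := by omega
  rw [blockCycle, List.formPerm_apply_lt_getElem _ (B.sort_nodup _) a ha']
  rcases h _ ((B.mem_sort (· ≤ ·)).1 (List.getElem_mem ha')) with h1 | h1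
  · have := hs.getElem_le_getElem_iff.1 h1
    omega
  · have := hs.getElem_le_getElem_iff.1 h1
    have : b = a + 1 := by omega
    subst this
    rfl

theorem blockCycle_of_last {B : Finset (Fin n)} {i m : Fin n} (hi : i ∈ B) (hm : m ∈ B)
    (h : ∀ k ∈ B, k ≤ i) (h' : ∀ k ∈ B, m ≤ k) : blockCycle B i = m := by
  have hs := B.sortedLT_sort
  obtain ⟨a, ha, rfl⟩ := List.getElem_of_mem ((B.mem_sort (· ≤ ·)).2 hi)
  obtain ⟨b, hb, rfl⟩ := List.getElem_of_mem ((B.mem_sort (· ≤ ·)).2 hm)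
  have h1 := hs.getElem_le_getElem_iff.1 (h _ ((B.mem_sort (· ≤ ·)).1
    (List.getElem_mem (show (B.sort (· ≤ ·)).length - 1 < _ by omega))))
  have h2 := hs.getElem_le_getElem_iff.1 (h' _ ((B.mem_sort (· ≤ ·)).1
    (List.getElem_mem (show 0 < (B.sort (· ≤ ·)).length by omega))))
  rw [blockCycle, List.formPerm_apply_getElem _ (B.sort_nodup _) a ha]
  congr 1
  have : a + 1 = (B.sort (· ≤ ·)).length := by omega
  rw [this, Nat.mod_self]
  omega

theorem bar_of_next {x : NC n} {i j : Fin n} (h : x.Rel i j) (hij : i < j)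
    (hno : ∀ k, x.Rel k i → k ≤ i ∨ j ≤ k) : x.bar i = j :=
  blockCycle_of_next (mem_part_iff.2 (Rel.refl x i)) (mem_part_iff.2 h.symm) hij
    fun k hk => hno k (mem_part_iff.1 hk)

theorem bar_of_last {x : NC n} {i m : Fin n} (h : x.Rel i m) (h1 : ∀ k, x.Rel k i → k ≤ i)
    (h2 : ∀ k, x.Rel k i → m ≤ k) : x.bar i = m :=
  blockCycle_of_last (mem_part_iff.2 (Rel.refl x i)) (mem_part_iff.2 h.symm)
    (fun k hk => h1 k (mem_part_iff.1 hk)) fun k hk => h2 k (mem_part_iff.1 hk)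

theorem exists_next {x : NC n} {a b : Fin n} (h : x.Rel a b) (hab : a < b) :
    ∃ c, x.Rel a c ∧ a < c ∧ c ≤ b ∧ ∀ k, x.Rel k a → k ≤ a ∨ c ≤ k := by
  obtain ⟨c, hc⟩ := exists_isLeast_fin (S := {c | x.Rel a c ∧ a < c}) ⟨b, h, hab⟩
  refine ⟨c, hc.1.1, hc.1.2, hc.2 ⟨h, hab⟩, fun k hk => ?_⟩
  rcases le_or_gt k a with h1 | h1
  · exact Or.inl h1
  · exact Or.inr (hc.2 ⟨hk.symm, h1⟩)

theorem bar_spec (x : NC n) (a : Fin n) :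
    (x.Rel a (x.bar a) ∧ a < x.bar a ∧ ∀ k, x.Rel k a → k ≤ a ∨ x.bar a ≤ k) ∨
      (x.Rel a (x.bar a) ∧ (∀ k, x.Rel k a → k ≤ a) ∧ ∀ k, x.Rel k a → x.bar a ≤ k) := by
  by_cases h : ∃ b, x.Rel a b ∧ a < b
  · obtain ⟨b, hb, hab⟩ := h
    obtain ⟨c, h1, h2, -, h3⟩ := exists_next hb hab
    rw [bar_of_next h1 h2 h3]
    exact Or.inl ⟨h1, h2, h3⟩
  · push Not at h
    obtain ⟨m, hm⟩ := exists_isLeast_fin (S := {c | x.Rel c a}) ⟨a, Rel.refl x a⟩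
    rw [bar_of_last (m := m) hm.1.symm (fun k hk => h k hk.symm) fun k hk => hm.2 hk]
    exact Or.inr ⟨hm.1.symm, fun k hk => h k hk.symm, fun k hk => hm.2 hk⟩

/-- Only the cyclic predecessors of `i` and `j` change their successors: the one of `i` now skips to
`j`, and the one of `j` closes the piece `[i, j)` by returning to `i`. -/
theorem bar_cut {x : NC n} {i j : Fin n} (hij : i < j) (hr : x.Rel i j) :
    (x.cut i j).bar = Equiv.swap i j * x.bar := by
  have hsub : ∀ {a b}, (x.cut i j).Rel a b → x.Rel a b := fun h => (cut_rel.1 h).1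
  ext1 a
  rw [Equiv.Perm.mul_apply]
  by_cases hi : x.bar a = i
  · rw [hi, Equiv.swap_apply_left]
    rcases x.bar_spec a with ⟨h1, h2, h3⟩ | ⟨h1, h2, h3⟩ <;> simp only [hi] at h1 h2 h3
    · refine bar_of_next (cut_rel.2 ⟨h1.trans hr, fun _ => by simp [h2]⟩) (h2.trans hij)
        fun k hk => ?_
      obtain ⟨h4, h5⟩ := cut_rel.1 hk
      rcases h3 k h4 with h6 | h6
      · exact Or.inl h6
      · have := h5 (h4.trans h1)
        simp only [h6, h2.not_ge, true_and, false_and, iff_false, not_lt] at this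
        exact Or.inr this
    · have hja := h2 j (h1.trans hr).symm
      refine bar_of_last (cut_rel.2 ⟨h1.trans hr, fun _ => by simp [hja]⟩)
        (fun k hk => h2 k (hsub hk)) fun k hk => ?_
      obtain ⟨h4, h5⟩ := cut_rel.1 hk
      have := h5 (h4.trans h1)
      simp only [h3 k h4, hja.not_gt, true_and, and_false, iff_false, not_lt] at this
      exact this
  by_cases hj : x.bar a = j
  · rw [hj, Equiv.swap_apply_right]
    rcases x.bar_spec a with ⟨h1, h2, h3⟩ | ⟨h1, h2, h3⟩ <;> simp only [hj] at h1 h2 h3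
    · have hia : i ≤ a := (h3 i (hr.trans h1.symm)).resolve_right hij.not_ge
      refine bar_of_last (cut_rel.2 ⟨h1.trans hr.symm, fun _ => by simp [hia, h2, hij]⟩)
        (fun k hk => ?_) fun k hk => ?_ <;>
      · obtain ⟨h4, h5⟩ := cut_rel.1 hk
        have := h5 (h4.trans (h1.trans hr.symm))
        simp only [hia, h2, and_self, iff_true] at this
        first
          | exact this.1
          | exact (h3 k h4).resolve_right this.2.not_ge
    · exact absurd (h3 i (hr.trans h1.symm)) hij.not_ge
  rw [Equiv.swap_apply_of_ne_of_ne hi hj]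
  rcases x.bar_spec a with ⟨h1, h2, h3⟩ | ⟨h1, h2, h3⟩
  · refine bar_of_next (cut_rel.2 ⟨h1, fun ha => ?_⟩) h2 fun k hk => h3 k (hsub hk)
    have hi' := h3 i ha.symm
    have hj' := h3 j (hr.symm.trans ha.symm)
    have hi : i ≠ x.bar a := Ne.symm hi
    have hj : j ≠ x.bar a := Ne.symm hj
    constructor <;> intro h <;> constructor <;> omega
  · refine bar_of_last (cut_rel.2 ⟨h1, fun ha => ?_⟩) (fun k hk => h2 k (hsub hk))
      fun k hk => h3 k (hsub hk)
    have hi' := h3 i ha.symm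
    have hj' := h2 j (hr.symm.trans ha.symm)
    have hi : i ≠ x.bar a := Ne.symm hi
    constructor <;> intro h <;> constructor <;> omega

theorem label_cut {x : NC n} {i j : Fin n} (hij : i < j) (hr : x.Rel i j) :
    label x (x.cut i j) = toLex ((i : WithTop (Fin n)), (j : WithBot (Fin n))) := by
  rw [label, bar_cut hij hr, mul_inv_cancel_right, Equiv.Perm.support_swap hij.ne,
    Finset.min_insert, Finset.max_insert, Finset.min_singleton, Finset.max_singleton,
    ← WithTop.coe_min, ← WithBot.coe_max, min_eq_left hij.le, max_eq_right hij.le]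

theorem label_cut_lt_iff {x y : NC n} {i j k l : Fin n} (hij : i < j) (hr : x.Rel i j)
    (hkl : k < l) (hr' : y.Rel k l) : label x (x.cut i j) < label y (y.cut k l) ↔
      i < k ∨ i = k ∧ j < l := by
  rw [label_cut hij hr, label_cut hkl hr', Prod.Lex.toLex_lt_toLex, WithTop.coe_lt_coe,
    WithTop.coe_inj, WithBot.coe_lt_coe]

theorem isSwap_of_covBy {x y : NC n} (h : x ⋖ y) : (y.bar * x.bar⁻¹).IsSwap := by
  obtain ⟨i, j, hij, hr, rfl⟩ := covBy_iff_exists_cut.1 h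
  exact ⟨i, j, hij.ne, by rw [bar_cut hij hr, mul_inv_cancel_right]⟩

theorem isInjectiveOnCovers_label : IsInjectiveOnCovers (label (n := n)) := by
  intro x y y' h h' he
  obtain ⟨i, j, hij, hr, rfl⟩ := covBy_iff_exists_cut.1 h
  obtain ⟨k, l, hkl, hr', rfl⟩ := covBy_iff_exists_cut.1 h'
  rw [label_cut hij hr, label_cut hkl hr', toLex_inj, Prod.mk.injEq, WithTop.coe_inj,
    WithBot.coe_inj] at he
  rw [he.1, he.2]

/-- If the label of an atom of `[b, y]` does not exceed that of the atom `b` of `[x, y]`, then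
`b` does not have the least label among the atoms of `[x, y]`. -/
theorem exists_label_lt_of_le {x b c y : NC n} (hxb : x ⋖ b) (hbc : b ⋖ c) (hcy : c ≤ y)
    (h : label b c ≤ label x b) : ∃ a, x ⋖ a ∧ a ≤ y ∧ label x a < label x b := by
  obtain ⟨i, j, hij, hr, rfl⟩ := covBy_iff_exists_cut.1 hxb
  obtain ⟨k, l, hkl, hr', rfl⟩ := covBy_iff_exists_cut.1 hbc
  rw [← not_lt, label_cut_lt_iff hij hr hkl hr'] at h
  have hby := hbc.le.trans hcy
  have hxy := hxb.le.trans hby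
  have hb := (cut_le_iff hxy).1 hby
  have hc := (cut_le_iff hby).1 hcy
  have hkl' := cut_rel.1 hr'
  have hne : ¬ (k = i ∧ l = j) := by
    rintro ⟨rfl, rfl⟩
    exact not_cut_rel hkl hr'
  -- The second cut can be made first. Elements of the block in `[k, l)` outside the piece of `k`
  -- lie in `[i, j)`, and then `[i, j)` lies in `[k, l)`, so no block of `y` is broken.
  refine ⟨x.cut k l, covBy_cut hkl hkl'.1, (cut_le_iff hxy).2 fun a b hab hak hka hal => ?_,
    (label_cut_lt_iff hkl hkl'.1 hij hr).2 (by omega)⟩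
  by_cases hki : x.Rel k i
  · have h1 := hkl'.2 hki
    by_cases h2 : (x.cut i j).Rel a k
    · exact hc a b hab h2 hka hal
    · rw [cut_rel] at h2
      have h3 : ¬ ((i ≤ a ∧ a < j) ↔ (i ≤ k ∧ k < j)) := fun h3 => h2 ⟨hak, fun _ => h3⟩
      have h4 := hb a b hab (hak.trans hki)
      omega
  · exact hc a b hab (cut_rel.2 ⟨hak, fun hai => absurd (hak.symm.trans hai) hki⟩) hka hal

/-- If the atom `b` does not have the least label among the atoms of `[x, y]`, then there is an
atom of `[b, y]` with a label smaller than that of `b`. -/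
theorem exists_label_lt_of_lt {x a b y : NC n} (hxa : x ⋖ a) (hay : a ≤ y) (hxb : x ⋖ b)
    (hby : b ≤ y) (h : label x a < label x b) : ∃ c, b ⋖ c ∧ c ≤ y ∧ label b c < label x b := by
  obtain ⟨i, j, hij, hr, rfl⟩ := covBy_iff_exists_cut.1 hxb
  obtain ⟨k, l, hkl, hr', rfl⟩ := covBy_iff_exists_cut.1 hxa
  rw [label_cut_lt_iff hkl hr' hij hr] at h
  have hxy := hxb.le.trans hby
  have ha := (cut_le_iff hxy).1 hay
  have hb := (cut_le_iff hxy).1 hby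
  have key : ∀ m, k < m → (x.cut i j).Rel k m → (k < i ∨ k = i ∧ m < j) →
      (∀ e f, y.Rel e f → (x.cut i j).Rel e k → k ≤ e → e < m → k ≤ f ∧ f < m) →
      ∃ c, x.cut i j ⋖ c ∧ c ≤ y ∧ label (x.cut i j) c < label x (x.cut i j) :=
    fun m h1 h2 h3 h4 => ⟨_, covBy_cut h1 h2, (cut_le_iff hby).2 h4,
      (label_cut_lt_iff h1 h2 hij hr).2 h3⟩
  by_cases hki : x.Rel k i
  · have hmem : ∀ e f, y.Rel e f → (x.cut i j).Rel e k → x.Rel e i ∧ x.Rel e k ∧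
        ((i ≤ e ∧ e < j) ↔ (i ≤ k ∧ k < j)) ∧ ((i ≤ f ∧ f < j) ↔ (i ≤ k ∧ k < j)) ∧
          (k ≤ e → e < l → k ≤ f ∧ f < l) := by
      intro e f hef hek
      obtain ⟨h1, h2⟩ := cut_rel.1 hek
      have h3 := (cut_rel.1 (hef.mono hby)).2 (h1.trans hki)
      have h2 := h2 (h1.trans hki)
      exact ⟨h1.trans hki, h1, h2, h3.symm.trans h2, ha e f hef h1⟩
    -- Only in this case does the first cut separate `l` from `k`. Then `(k, j)` serves instead: its
    -- first entry is already less than `i`, and `[k, j)` is the union of `[k, l)` and `[i, j)`.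
    by_cases hil : k < i ∧ i ≤ l ∧ l < j
    · refine key j (by omega) (cut_rel.2 ⟨hki.trans hr, fun _ => by omega⟩) (Or.inl hil.1) ?_
      intro e f hef hek h1 h2
      have := hmem e f hef hek
      omega
    · refine key l hkl (cut_rel.2 ⟨hr', fun _ => by omega⟩) (by omega) ?_
      intro e f hef hek h1 h2
      exact (hmem e f hef hek).2.2.2.2 h1 h2
  · refine key l hkl (cut_rel.2 ⟨hr', fun h => absurd h hki⟩) (by omega) fun e f hef hek => ?_
    exact ha e f hef (cut_rel.1 hek).1

end NC

/-! ### Saturated chains and EL-labelings -/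

section ELLabelings

variable {P Λ : Type*} [PartialOrder P]

theorem isSaturatedChain_cons_cons {x y a b : P} {c : List P} :
    IsSaturatedChain x y (a :: b :: c) ↔ a = x ∧ x ⋖ b ∧ IsSaturatedChain b y (b :: c) := by
  simp only [IsSaturatedChain, List.head?_cons, Option.some.injEq, List.getLast?_cons_cons,
    List.isChain_cons_cons, true_and]
  constructor
  · rintro ⟨rfl, h1, h2, h3⟩
    exact ⟨rfl, h2, h1, h3⟩
  · rintro ⟨rfl, h1, h2, h3⟩
    exact ⟨rfl, h2, h1, h3⟩

theorem isSaturatedChain_singleton {x y a : P} : IsSaturatedChain x y [a] ↔ a = x ∧ a = y := by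
  simp [IsSaturatedChain]

theorem IsSaturatedChain.cases {x y : P} {c : List P} (h : IsSaturatedChain x y c) :
    (x = y ∧ c = [x]) ∨ ∃ b c', c = x :: b :: c' ∧ x ⋖ b ∧ IsSaturatedChain b y (b :: c') := by
  match c, h with
  | [], h => simp [IsSaturatedChain] at h
  | [a], h =>
    obtain ⟨rfl, rfl⟩ := isSaturatedChain_singleton.1 h
    exact Or.inl ⟨rfl, rfl⟩
  | a :: b :: c, h =>
    obtain ⟨rfl, h1, h2⟩ := isSaturatedChain_cons_cons.1 h
    exact Or.inr ⟨b, c, rfl, h1, h2⟩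

theorem IsSaturatedChain.le {x y : P} {c : List P} (h : IsSaturatedChain x y c) : x ≤ y := by
  induction c generalizing x with
  | nil => simp [IsSaturatedChain] at h
  | cons a c ih =>
    rcases h.cases with ⟨rfl, -⟩ | ⟨b, c', he, hxb, h'⟩
    · exact le_rfl
    · rw [List.cons.injEq] at he
      rw [← he.2] at h'
      exact hxb.le.trans (ih h')

theorem IsSaturatedChain.eq_singleton {x : P} {c : List P} (h : IsSaturatedChain x x c) :
    c = [x] := by
  rcases h.cases with ⟨-, h⟩ | ⟨b, c', -, hxb, h'⟩
  · exact h
  · exact absurd h'.le hxb.lt.not_ge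

theorem IsSaturatedChain.exists_cons {x y : P} {c : List P} (h : IsSaturatedChain x y c) :
    ∃ c', c = x :: c' := by
  rcases h.cases with ⟨-, h⟩ | ⟨b, c', h, -⟩
  · exact ⟨[], h⟩
  · exact ⟨b :: c', h⟩

theorem exists_covBy_le_of_finite [Finite P] {x y : P} (h : x < y) : ∃ b, x ⋖ b ∧ b ≤ y := by
  obtain ⟨b, hb⟩ := Set.Finite.exists_minimal (Set.toFinite {b | x < b ∧ b ≤ y}) ⟨y, h, le_rfl⟩
  refine ⟨b, ⟨hb.1.1, fun c h1 h2 => ?_⟩, hb.1.2⟩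
  exact h2.not_ge (hb.2 ⟨h1, h2.le.trans hb.1.2⟩ h2.le)

theorem exists_isSaturatedChain [Finite P] {x y : P} (h : x ≤ y) :
    ∃ c, IsSaturatedChain x y c := by
  induction x using WellFoundedGT.induction with
  | _ x ih =>
    rcases h.eq_or_lt with rfl | h
    · exact ⟨[x], isSaturatedChain_singleton.2 ⟨rfl, rfl⟩⟩
    · obtain ⟨b, hxb, hby⟩ := exists_covBy_le_of_finite h
      obtain ⟨c, hc⟩ := ih b hxb.lt hby
      obtain ⟨c', rfl⟩ := hc.exists_cons
      exact ⟨x :: b :: c', isSaturatedChain_cons_cons.2 ⟨rfl, hxb, hc⟩⟩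

theorem labelWord_cons_cons {P Λ : Type*} (lab : P → P → Λ) (a b : P) (c : List P) :
    labelWord lab (a :: b :: c) = lab a b :: labelWord lab (b :: c) := rfl

variable [LinearOrder Λ]

/-- A local criterion for EL-labelings that are injective on covers: the atom with the least label
is the only one that may be followed by a greater label. -/
theorem isELLabeling_of_atoms [Finite P] {lab : P → P → Λ} (hinj : IsInjectiveOnCovers lab)
    (h₁ : ∀ x b c y : P, x ⋖ b → b ⋖ c → c ≤ y → lab b c ≤ lab x b →
      ∃ a, x ⋖ a ∧ a ≤ y ∧ lab x a < lab x b)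
    (h₂ : ∀ x a b y : P, x ⋖ a → a ≤ y → x ⋖ b → b ≤ y → lab x a < lab x b →
      ∃ c, b ⋖ c ∧ c ≤ y ∧ lab b c < lab x b) : IsELLabeling lab := by
  intro x y
  induction x using WellFoundedGT.induction with
  | _ x ih =>
    intro h
    rcases h.eq_or_lt with rfl | h
    · refine ⟨[x], isSaturatedChain_singleton.2 ⟨rfl, rfl⟩, by simp [labelWord],
        fun c' hc' _ => hc'.eq_singleton, fun c' hc' => ?_⟩
      rw [hc'.eq_singleton]
    · obtain ⟨b, ⟨hxb, hby⟩, hmin⟩ := Set.exists_min_image {b | x ⋖ b ∧ b ≤ y} (lab x)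
        (Set.toFinite _) (exists_covBy_le_of_finite h)
      have hlt : ∀ b', x ⋖ b' → b' ≤ y → b' ≠ b → lab x b < lab x b' := fun b' h1 h2 hne =>
        lt_of_le_of_ne (hmin b' ⟨h1, h2⟩) fun he => hne (hinj x _ _ hxb h1 he).symm
      obtain ⟨c, hc, hci, hcu, hcl⟩ := ih b hxb.lt hby
      obtain ⟨d, rfl⟩ := hc.exists_cons
      refine ⟨x :: b :: d, isSaturatedChain_cons_cons.2 ⟨rfl, hxb, hc⟩, ?_, ?_, ?_⟩
      · rw [labelWord_cons_cons]
        rcases hc.cases with ⟨-, h1⟩ | ⟨e, d', h1, hbe, he⟩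
        · rw [h1]
          simp [labelWord]
        · rw [h1, labelWord_cons_cons] at hci ⊢
          refine List.isChain_cons_cons.2 ⟨?_, hci⟩
          by_contra! hle
          obtain ⟨a, hxa, hay, hab⟩ := h₁ x b e y hxb hbe he.le hle
          exact hab.not_ge (hmin a ⟨hxa, hay⟩)
      · intro c' hc' hci'
        rcases hc'.cases with ⟨rfl, -⟩ | ⟨b', d', rfl, hxb', hd'⟩
        · exact absurd h (lt_irrefl x)
        rw [labelWord_cons_cons] at hci'
        -- Above a wrong atom `b'` there is an atom with a label less than that of `b'`. The
        -- increasing chain from `b'` is lexicographically minimal, so its first label is no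
        -- greater, and the word would descend at `b'`.
        have hb : b' = b := by
          by_contra hne
          obtain ⟨e, hbe, hey, hlab⟩ := h₂ x b b' y hxb hby hxb' hd'.le (hlt b' hxb' hd'.le hne)
          obtain ⟨f, hf, -, hfu, hfl⟩ := ih b' hxb'.lt hd'.le
          obtain rfl := hfu _ hd' hci'.tail
          obtain ⟨g, hg⟩ := exists_isSaturatedChain hey
          obtain ⟨g', rfl⟩ := hg.exists_cons
          have h3 := hfl _ (isSaturatedChain_cons_cons.2 ⟨rfl, hbe, hg⟩)
          rcases hd'.cases with ⟨rfl, -⟩ | ⟨k, d'', he, -, -⟩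
          · exact absurd hey hbe.lt.not_ge
          · rw [he, labelWord_cons_cons] at hci'
            rw [he, labelWord_cons_cons, labelWord_cons_cons, ← not_lt, List.cons_lt_cons_iff] at h3
            exact h3 (Or.inl (hlab.trans (List.isChain_cons_cons.1 hci').1))
        subst hb
        rw [hcu _ hd' hci'.tail]
      · intro c' hc'
        rcases hc'.cases with ⟨rfl, -⟩ | ⟨b', d', rfl, hxb', hd'⟩
        · exact absurd h (lt_irrefl x)
        rw [labelWord_cons_cons, labelWord_cons_cons, ← not_lt, List.cons_lt_cons_iff]
        by_cases hb : b' = b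
        · subst hb
          rintro (h3 | ⟨-, h3⟩)
          · exact lt_irrefl _ h3
          · exact h3.not_ge (hcl _ hd')
        · have := hlt b' hxb' hd'.le hb
          rintro (h3 | ⟨h3, -⟩)
          · exact lt_asymm this h3
          · exact this.ne' h3

/-- In an EL-labeled interval, if no atom of `[x, z]` has a label less than that of `y` and `z`
has the least label among the atoms of `[y, w]`, then `y` has the least label among the atoms
of `[x, w]`. -/
theorem IsELLabeling.le_of_forall_le [Finite P] {lab : P → P → Λ} (hlab : IsELLabeling lab)
    (hinj : IsInjectiveOnCovers lab) {x y z w y' : P} (hxy : x ⋖ y) (hyz : y ⋖ z) (hzw : z ≤ w)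
    (h₀ : ∀ a b, x ⋖ a → a ⋖ b → b ≤ z → b = z) (h₁ : ∀ a, x ⋖ a → a ⋖ z → lab x y ≤ lab x a)
    (h₂ : ∀ a, y ⋖ a → a ≤ w → lab y z ≤ lab y a) (hxy' : x ⋖ y') (hyw : y' ≤ w) :
    lab x y ≤ lab x y' := by
  have first : ∀ {x y w : P} {c : List P}, x ⋖ y → y ≤ w →
      (∀ c', IsSaturatedChain x w c' → labelWord lab c ≤ labelWord lab c') →
      ∀ {a d}, c = x :: a :: d → lab x a ≤ lab x y := by
    intro x y w c h1 h2 h3 a d hc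
    obtain ⟨g, hg⟩ := exists_isSaturatedChain h2
    obtain ⟨g', rfl⟩ := hg.exists_cons
    have h4 := h3 _ (isSaturatedChain_cons_cons.2 ⟨rfl, h1, hg⟩)
    rw [hc, labelWord_cons_cons, labelWord_cons_cons, ← not_lt, List.cons_lt_cons_iff] at h4
    by_contra! h5
    exact h4 (Or.inl h5)
  obtain ⟨c, hc, hci, -, hcl⟩ := hlab y w (hyz.le.trans hzw)
  rcases hc.cases with ⟨rfl, -⟩ | ⟨a, d, rfl, hya, hd⟩
  · exact absurd hzw hyz.lt.not_ge
  obtain rfl : a = z := hinj y _ _ hya hyz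
    (le_antisymm (first hyz hzw hcl rfl) (h₂ a hya hd.le))
  -- The increasing chain of `[x, a]` has length two by `h₀`. It starts with a least label, so by
  -- `h₁` and injectivity it passes through `y`.
  have hinc : lab x y < lab y a := by
    obtain ⟨f, hf, hfi, hfu, hfl⟩ := hlab x a (hxy.le.trans hyz.le)
    rcases hf.cases with ⟨rfl, -⟩ | ⟨b, g, rfl, hxb, hg⟩
    · exact absurd hxy.le hyz.lt.not_ge
    have hle : lab x b ≤ lab x y := first hxy hyz.le hfl rfl
    rcases hg.cases with ⟨rfl, -⟩ | ⟨e, g', he, hbe, hg'⟩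
    · exact absurd hyz.lt (hxb.2 hxy.lt)
    rw [List.cons.injEq] at he
    obtain ⟨-, rfl⟩ := he
    rw [labelWord_cons_cons, labelWord_cons_cons] at hfi
    have hlt := (List.isChain_cons_cons.1 hfi).1
    obtain rfl : e = a := h₀ b e hxb hbe hg'.le
    obtain rfl : b = y := hinj x _ _ hxb hxy (le_antisymm hle (h₁ b hxb hbe))
    exact hlt
  obtain ⟨f, hf, -, hfu, hfl⟩ := hlab x w (hxy.le.trans (hyz.le.trans hzw))
  -- Prefixing `x` to the increasing chain of `[y, w]` keeps it increasing, hence it is the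
  -- lexicographically minimal chain of `[x, w]`.
  have : x :: y :: a :: d = f := by
    refine hfu _ (isSaturatedChain_cons_cons.2 ⟨rfl, hxy, hc⟩) ?_
    rw [labelWord_cons_cons]
    rw [labelWord_cons_cons] at hci ⊢
    exact List.isChain_cons_cons.2 ⟨hinc, hci⟩
  exact first hxy' hyw hfl this.symm

end ELLabelings

theorem NC.isELLabeling_label {n : ℕ} : IsELLabeling (NC.label (n := n)) :=
  isELLabeling_of_atoms NC.isInjectiveOnCovers_label
    (fun _ _ _ _ h1 h2 h3 h4 => NC.exists_label_lt_of_le h1 h2 h3 h4)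
    fun _ _ _ _ h1 h2 h3 h4 h5 => NC.exists_label_lt_of_lt h1 h2 h3 h4 h5

/-! ### Common refinements -/

namespace NC

variable {n : ℕ}

/-- The coarsest common refinement of two noncrossing partitions. -/
noncomputable def commonRefinement (x y : NC n) : NC n :=
  ofSetoid
    { r := fun a b => x.Rel a b ∧ y.Rel a b
      iseqv :=
        { refl := fun a => ⟨Rel.refl x a, Rel.refl y a⟩
          symm := fun h => ⟨h.1.symm, h.2.symm⟩
          trans := fun h h' => ⟨h.1.trans h'.1, h.2.trans h'.2⟩ } }
    fun _ _ _ _ hij hjk hkl h h' => ⟨h.1.noncrossing h'.1 hij.le hjk.le hkl.le,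
      h.2.noncrossing h'.2 hij.le hjk.le hkl.le⟩

theorem commonRefinement_rel {x y : NC n} {a b : Fin n} :
    (commonRefinement x y).Rel a b ↔ x.Rel a b ∧ y.Rel a b :=
  ofSetoid_rel

theorem commonRefinement_le {x y z : NC n} (h : x ≤ z) (h' : y ≤ z) : commonRefinement x y ≤ z :=
  le_iff_rel.2 fun _ _ hr => commonRefinement_rel.2 ⟨hr.mono h, hr.mono h'⟩

theorem le_commonRefinement_left (x y : NC n) : x ≤ commonRefinement x y :=
  le_iff_rel.2 fun _ _ hr => (commonRefinement_rel.1 hr).1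

theorem le_commonRefinement_right (x y : NC n) : y ≤ commonRefinement x y :=
  le_iff_rel.2 fun _ _ hr => (commonRefinement_rel.1 hr).2

end NC

/-! ### Codes -/

section Codes

variable {n : ℕ} {α β γ : Equiv.Perm (Fin n)}

/-- Counted by positions instead of values, the entry visibly depends only on where the values `≥ i`
stand. The value `i` itself is excluded by the strict inequality of positions. -/
theorem codeEntry_eq_card (σ : Equiv.Perm (Fin n)) (i : Fin n) :
    codeEntry σ i = (Finset.univ.filter fun p => σ.symm i < p ∧ ¬ i < σ p).card := by
  rw [codeEntry, ← Finset.card_map σ.symm.toEmbedding]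
  congr 1
  ext p
  simp only [Finset.mem_map_equiv, Equiv.symm_symm, Finset.mem_filter, Finset.mem_univ, true_and,
    Equiv.symm_apply_apply, not_lt]
  constructor
  · exact fun h => ⟨h.2, h.1.le⟩
  · refine fun h => ⟨lt_of_le_of_ne h.2 ?_, h.1⟩
    rintro rfl
    exact absurd h.1 (by simp)

theorem lt_apply_iff_of_eqOn {d : Fin n} (h : Set.EqOn α.symm β.symm (Set.Ioi d)) (p : Fin n) :
    d < α p ↔ d < β p := by
  have key : ∀ {α β : Equiv.Perm (Fin n)}, Set.EqOn α.symm β.symm (Set.Ioi d) →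
      d < α p → d < β p := fun {α β} h h' => by
    have h1 := h h'
    rw [Equiv.symm_apply_apply] at h1
    rw [h1, Equiv.apply_symm_apply]
    exact h'
  exact ⟨key h, key h.symm⟩

/-- Entries above `d` coincide. At `d`, moving left enlarges the set of counted positions, which
gains at least the old position of `d`. -/
theorem code_lt_of_eqOn {d : Fin n} (h : Set.EqOn α.symm β.symm (Set.Ioi d))
    (hd : β.symm d < α.symm d) : code α < code β := by
  refine ⟨Fin.rev d, fun j hj => ?_, ?_⟩
  · have hj' : d < Fin.rev j := by
      rwa [← Fin.rev_lt_rev, Fin.rev_rev]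
    change codeEntry α (Fin.rev j) = codeEntry β (Fin.rev j)
    rw [codeEntry_eq_card, codeEntry_eq_card, h hj']
    have h' := h.mono (Set.Ioi_subset_Ioi hj'.le)
    simp only [lt_apply_iff_of_eqOn h']
  · change codeEntry α (Fin.rev (Fin.rev d)) < codeEntry β (Fin.rev (Fin.rev d))
    rw [Fin.rev_rev, codeEntry_eq_card, codeEntry_eq_card]
    apply Finset.card_lt_card
    rw [Finset.ssubset_iff_of_subset]
    · refine ⟨α.symm d, ?_, by simp⟩
      simp only [Finset.mem_filter, Finset.mem_univ, hd, ← lt_apply_iff_of_eqOn h]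
      simp
    · intro p
      simp only [Finset.mem_filter, Finset.mem_univ, true_and, lt_apply_iff_of_eqOn h]
      exact fun hp => ⟨hd.trans hp.1, hp.2⟩

theorem exists_eqOn_Ioi_ne (h : α ≠ β) :
    ∃ d, Set.EqOn α.symm β.symm (Set.Ioi d) ∧ α.symm d ≠ β.symm d := by
  have hne : {v | α.symm v ≠ β.symm v}.Nonempty := by
    by_contra hc
    rw [Set.not_nonempty_iff_eq_empty, Set.eq_empty_iff_forall_notMem] at hc
    refine h (Equiv.symm_bijective.injective (Equiv.ext fun v => ?_))
    simpa using hc v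
  obtain ⟨d, hd, hmax⟩ := Set.exists_max_image _ id (Set.toFinite _) hne
  refine ⟨d, fun v hv => ?_, hd⟩
  by_contra hc
  exact (hmax v hc).not_gt hv

theorem code_lt_iff : code α < code β ↔
    ∃ d, Set.EqOn α.symm β.symm (Set.Ioi d) ∧ β.symm d < α.symm d := by
  refine ⟨fun h => ?_, fun ⟨d, h, h'⟩ => code_lt_of_eqOn h h'⟩
  obtain ⟨d, hd, hne⟩ := exists_eqOn_Ioi_ne (α := α) (β := β) (by rintro rfl; exact lt_irrefl _ h)
  refine ⟨d, hd, lt_of_le_of_ne ?_ hne.symm⟩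
  by_contra! hlt
  exact lt_asymm h (code_lt_of_eqOn hd.symm hlt)

theorem code_injective : Function.Injective (code (n := n)) := by
  intro α β h
  by_contra hne
  obtain ⟨d, hd, hne⟩ := exists_eqOn_Ioi_ne hne
  rcases lt_or_gt_of_ne hne with hlt | hlt
  · exact (code_lt_of_eqOn hd.symm hlt).ne' h
  · exact (code_lt_of_eqOn hd hlt).ne h

/-- At the greatest value where `α` and `β` differ, `β` has it further left. If that value were in
`S`, `γ` would have it back at the place of `α`, making the code of `γ` less than that of `β`. -/
theorem eqOn_of_code_le_of_code_le {S : Set (Fin n)} (hS : IsUpperSet S)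
    (h₁ : code α ≤ code β) (h₂ : code β ≤ code γ) (h : Set.EqOn α.symm γ.symm S) :
    Set.EqOn α.symm β.symm S := by
  intro v hv
  by_contra hne
  obtain ⟨d, hd, hne'⟩ := exists_eqOn_Ioi_ne (α := α) (β := β) (by rintro rfl; exact hne rfl)
  have hvd : v ≤ d := by
    by_contra! h'
    exact hne (hd h')
  have hdS := hS hvd hv
  rcases lt_or_gt_of_ne hne' with hlt | hlt
  · exact h₁.not_gt (code_lt_of_eqOn hd.symm hlt)
  · refine h₂.not_gt (code_lt_of_eqOn (fun w hw => ?_) ((h hdS) ▸ hlt))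
    rw [← hd hw, h (hS (le_of_lt hw) hdS)]

end Codes

/-! ### Positions of values and the order on 2-partitions -/

namespace TwoPartition

variable {n : ℕ}

/-- The position of the value `v` in the permutation of `φ`. -/
noncomputable def pos (φ : TwoPartition n) (v : Fin n) : Fin n := φ.perm.symm v

theorem perm_pos (φ : TwoPartition n) (v : Fin n) : φ.perm (φ.pos v) = v :=
  Equiv.apply_symm_apply _ _

theorem pos_perm (φ : TwoPartition n) (i : Fin n) : φ.pos (φ.perm i) = i :=
  Equiv.symm_apply_apply _ _

theorem mem_lam_iff (φ : TwoPartition n) (B : {B // B ∈ φ.π.part.parts}) (v : Fin n) :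
    v ∈ (φ.lam B).1 ↔ φ.pos v ∈ B.1 := by
  rw [← perm_image, Finset.mem_image]
  constructor
  · rintro ⟨i, hi, rfl⟩
    rwa [pos_perm]
  · exact fun h => ⟨_, h, φ.perm_pos v⟩

theorem rel_of_mem {φ : TwoPartition n} {B : {B // B ∈ φ.π.part.parts}} {i j : Fin n}
    (hi : i ∈ B.1) (hj : j ∈ B.1) : φ.π.Rel i j :=
  (φ.π.part.part_eq_of_mem B.2 hi).trans (φ.π.part.part_eq_of_mem B.2 hj).symm

theorem mem_block_iff {φ : TwoPartition n} {i j : Fin n} : j ∈ (φ.block i).1 ↔ φ.π.Rel j i :=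
  NC.mem_part_iff

theorem perm_lt {φ : TwoPartition n} {i j : Fin n} (h : φ.π.Rel i j) (hij : i < j) :
    φ.perm i < φ.perm j :=
  φ.perm_strictMonoOn (φ.block j) (mem_block_iff.2 h) (φ.mem_block j) hij

/-- The image of a block is the set of values positioned in it, so containment of images can be
tested value by value. From here on `ρ` and `lam` enter only through positions. -/
theorem le_iff_pos {φ ψ : TwoPartition n} :
    φ ≤ ψ ↔ φ.π ≤ ψ.π ∧ ∀ v, φ.π.Rel (φ.pos v) (ψ.pos v) := by
  rw [le_def]
  constructor
  · intro h
    refine ⟨h.1, fun v => ?_⟩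
    obtain ⟨B', h1, h2⟩ := (le_iff_exists φ ψ).1 h (ψ.block (ψ.pos v))
    have h3 := h2 ((ψ.mem_lam_iff _ v).2 (ψ.mem_block _))
    exact rel_of_mem ((φ.mem_lam_iff _ v).1 h3) (h1 (ψ.mem_block _))
  · rintro ⟨h, h'⟩
    refine (le_iff_exists φ ψ).2 fun B => ?_
    obtain ⟨i, hi⟩ := ψ.π.part.nonempty_of_mem_parts B.2
    refine ⟨φ.block i, fun j hj => mem_block_iff.2 ((rel_of_mem hj hi).mono h), fun v hv => ?_⟩
    rw [mem_lam_iff, mem_block_iff] at *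
    exact (h' v).trans ((rel_of_mem hv hi).mono h)

theorem π_mono {φ ψ : TwoPartition n} (h : φ ≤ ψ) : φ.π ≤ ψ.π := (le_iff_pos.1 h).1

theorem rel_pos {φ ψ : TwoPartition n} (h : φ ≤ ψ) (v : Fin n) : φ.π.Rel (φ.pos v) (ψ.pos v) :=
  (le_iff_pos.1 h).2 v

theorem le_of_π_eq {φ ψ : TwoPartition n} (h : φ ≤ ψ) (hπ : φ.π = ψ.π) : φ = ψ :=
  le_antisymm h (le_iff_pos.2 ⟨hπ.ge, fun v => hπ ▸ (rel_pos h v).symm⟩)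

theorem π_strictMono {φ ψ : TwoPartition n} (h : φ < ψ) : φ.π < ψ.π :=
  lt_of_le_of_ne (π_mono h.le) fun he => h.ne (le_of_π_eq h.le he)

theorem ext_perm {φ ψ : TwoPartition n} (hπ : φ.π = ψ.π) (h : φ.perm = ψ.perm) : φ = ψ := by
  refine le_of_π_eq (le_iff_pos.2 ⟨hπ.le, fun v => ?_⟩) hπ
  rw [pos, pos, h]
  exact NC.Rel.refl _ _

instance : Finite (TwoPartition n) :=
  Finite.of_injective (fun φ => (φ.π, φ.perm)) fun _ _ h =>
    ext_perm (congrArg Prod.fst h) (congrArg Prod.snd h)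

/-- A position in the block of the value `v` that does not hold a greater value is at most the
position of `v`. -/
theorem le_pos_of_perm_le {φ : TwoPartition n} {v e : Fin n} (h : φ.π.Rel e (φ.pos v))
    (he : φ.perm e ≤ v) : e ≤ φ.pos v := by
  by_contra! hlt
  have := perm_lt h.symm hlt
  rw [perm_pos] at this
  exact this.not_ge he

/-- Which positions are left for `v` depends only on the places of the greater values, so any `β`
agreeing there can be consulted instead of `φ.perm`. -/
theorem le_pos_of_eqOn {φ : TwoPartition n} {β : Equiv.Perm (Fin n)} {v e : Fin n}
    (h : φ.π.Rel e (φ.pos v)) (hβ : Set.EqOn φ.perm.symm β.symm (Set.Ioi v)) (he : β e ≤ v) :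
    e ≤ φ.pos v :=
  le_pos_of_perm_le h (by
    have := (lt_apply_iff_of_eqOn hβ e).not
    simp only [not_lt] at this
    exact this.2 he)

/-- Once the greater values are placed equally, `φ` has `d` at the rightmost position left in its
block, and `ψ` must place `d` in the same block of `φ.π`. -/
theorem code_mono {φ ψ : TwoPartition n} (h : φ ≤ ψ) : code φ.perm ≤ code ψ.perm := by
  by_contra! hlt
  obtain ⟨d, hd, hd'⟩ := code_lt_iff.1 hlt
  refine hd'.not_ge (le_pos_of_eqOn (rel_pos h d).symm hd.symm ?_)
  rw [Equiv.apply_symm_apply]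

/-- The noncrossing 2-partition with first partition `x` which sends every block of `x` to its
image under `θ`. -/
noncomputable def of (x : NC n) (θ : Equiv.Perm (Fin n)) : TwoPartition n where
  π := x
  ρ := Finpartition.ofExistsUnique (x.part.parts.image fun B => B.image θ)
    (fun _ _ => Finset.subset_univ _)
    (fun v _ => by
      refine ⟨(x.part.part (θ.symm v)).image θ,
        ⟨Finset.mem_image_of_mem _ (x.part_mem_parts _), Finset.mem_image.2
          ⟨θ.symm v, NC.mem_part_iff.2 (NC.Rel.refl x _), Equiv.apply_symm_apply _ _⟩⟩, ?_⟩
      rintro _ ⟨hC, hv⟩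
      obtain ⟨B, hB, rfl⟩ := Finset.mem_image.1 hC
      obtain ⟨i, hi, rfl⟩ := Finset.mem_image.1 hv
      rw [Equiv.symm_apply_apply, x.part.part_eq_of_mem hB hi])
    (fun h => by
      obtain ⟨B, hB, h⟩ := Finset.mem_image.1 h
      exact (x.part.nonempty_of_mem_parts hB).ne_empty (Finset.image_eq_empty.1 h))
  lam := Equiv.ofBijective (fun B => ⟨B.1.image θ, Finset.mem_image_of_mem _ B.2⟩) (by
    constructor
    · rintro ⟨B, hB⟩ ⟨C, hC⟩ h
      exact Subtype.ext (Finset.image_injective θ.injective (congrArg Subtype.val h))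
    · rintro ⟨C, hC⟩
      obtain ⟨B, hB, rfl⟩ := Finset.mem_image.1 hC
      exact ⟨⟨B, hB⟩, rfl⟩)
  card_lam B := Finset.card_image_of_injective _ θ.injective

theorem of_π (x : NC n) (θ : Equiv.Perm (Fin n)) : (of x θ).π = x := rfl

theorem of_rel (x : NC n) (θ : Equiv.Perm (Fin n)) (v : Fin n) :
    x.Rel ((of x θ).pos v) (θ.symm v) := by
  have h : v ∈ ((of x θ).lam ((of x θ).block (θ.symm v))).1 :=
    Finset.mem_image.2 ⟨θ.symm v, (of x θ).mem_block _, Equiv.apply_symm_apply _ _⟩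
  exact mem_block_iff.1 ((mem_lam_iff _ _ _).1 h)

theorem le_of_iff {φ : TwoPartition n} {x : NC n} {θ : Equiv.Perm (Fin n)} :
    φ ≤ of x θ ↔ φ.π ≤ x ∧ ∀ v, φ.π.Rel (φ.pos v) (θ.symm v) := by
  rw [le_iff_pos]
  refine and_congr_right fun h => forall_congr' fun v => ?_
  have h1 := (of_rel x θ v).mono h
  exact ⟨fun h2 => h2.trans h1, fun h2 => h2.trans h1.symm⟩

theorem of_le_iff {φ : TwoPartition n} {x : NC n} {θ : Equiv.Perm (Fin n)} :
    of x θ ≤ φ ↔ x ≤ φ.π ∧ ∀ v, x.Rel (θ.symm v) (φ.pos v) := by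
  rw [le_iff_pos]
  refine and_congr_right fun h => forall_congr' fun v => ?_
  have h1 := of_rel x θ v
  exact ⟨fun h2 => h1.symm.trans h2, fun h2 => h1.trans h2⟩

theorem of_perm_le {φ : TwoPartition n} {x : NC n} (h : x ≤ φ.π) : of x φ.perm ≤ φ :=
  of_le_iff.2 ⟨h, fun _ => NC.Rel.refl _ _⟩

theorem le_of_perm {φ ψ : TwoPartition n} {x : NC n} (h : φ ≤ ψ) (hx : φ.π ≤ x) :
    φ ≤ of x ψ.perm :=
  le_of_iff.2 ⟨hx, rel_pos h⟩

/-- Keeping the permutation and refining the noncrossing partition. -/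
theorem perm_of_of_le {φ : TwoPartition n} {x : NC n} (h : φ.π ≤ x) :
    (of x φ.perm).perm = φ.perm := by
  by_contra hne
  obtain ⟨d, hd, hne⟩ := exists_eqOn_Ioi_ne hne
  have hr : x.Rel ((of x φ.perm).pos d) (φ.pos d) := of_rel x φ.perm d
  refine hne (le_antisymm (le_pos_of_eqOn (hr.mono h) hd.symm ?_) (le_pos_of_eqOn hr.symm hd ?_))
  · rw [Equiv.apply_symm_apply]
  · exact (perm_pos _ _).le

theorem le_of_of_le {φ : TwoPartition n} {x : NC n} (h : φ.π ≤ x) : φ ≤ of x φ.perm :=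
  le_of_perm le_rfl h

/-- Every noncrossing partition between `φ.π` and `ψ.π` lifts to a 2-partition between `φ` and `ψ`
by using `ψ.perm`. -/
theorem covBy_iff {φ ψ : TwoPartition n} : φ ⋖ ψ ↔ φ ≤ ψ ∧ φ.π ⋖ ψ.π := by
  constructor
  · intro h
    refine ⟨h.le, π_strictMono h.lt, fun x h1 h2 => ?_⟩
    refine h.2 (c := of x ψ.perm) ?_ ?_
    · refine lt_of_le_of_ne (le_of_perm h.le h1.le) fun he => h1.ne (congrArg π he)
    · exact lt_of_le_of_ne (of_perm_le h2.le) fun he => h2.ne (congrArg π he)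
  · rintro ⟨h, h'⟩
    refine ⟨lt_of_le_of_ne h fun he => h'.lt.ne (congrArg π he), fun χ h1 h2 => ?_⟩
    exact h'.2 (π_strictMono h1) (π_strictMono h2)

/-- The join of `φ` and `ψ` in the presence of a common upper bound `χ`. -/
theorem isLUB_of_commonRefinement {φ ψ χ : TwoPartition n} (h : φ ≤ χ) (h' : ψ ≤ χ) :
    IsLUB {φ, ψ} (of (NC.commonRefinement φ.π ψ.π) χ.perm) := by
  constructor
  · rintro _ (rfl | rfl)
    · exact le_of_perm h (NC.le_commonRefinement_left _ _)
    · exact le_of_perm h' (NC.le_commonRefinement_right _ _)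
  · intro ω hω
    have h1 : φ ≤ ω := hω (Or.inl rfl)
    have h2 : ψ ≤ ω := hω (Or.inr rfl)
    refine of_le_iff.2 ⟨NC.commonRefinement_le (π_mono h1) (π_mono h2), fun v => ?_⟩
    exact NC.commonRefinement_rel.2 ⟨(rel_pos h v).symm.trans (rel_pos h1 v),
      (rel_pos h' v).symm.trans (rel_pos h2 v)⟩

/-- Where the permutations of `φ` and `ψ` agree on all sufficiently large values, that of their
join does, too. -/
theorem eqOn_join {φ ψ κ : TwoPartition n} (h : φ ≤ κ) (h' : ψ ≤ κ)
    (hκ : κ.π = NC.commonRefinement φ.π ψ.π) {S : Set (Fin n)} (hS : IsUpperSet S)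
    (hE : Set.EqOn φ.perm.symm ψ.perm.symm S) : Set.EqOn φ.perm.symm κ.perm.symm S := by
  intro v
  -- From the greatest value downwards. The common position of `v` in `φ` and `ψ` lies in the right
  -- block of `κ`, and that block lies inside the one of `φ`, so the rightmost free positions
  -- coincide.
  induction v using WellFoundedGT.induction with
  | _ v ih =>
    intro hv
    have hE' : Set.EqOn φ.perm.symm κ.perm.symm (Set.Ioi v) := fun w hw =>
      ih w hw (hS (le_of_lt hw) hv)
    have h1 := rel_pos h v
    have h2 := rel_pos h' v
    have h3 : ψ.pos v = φ.pos v := (hE hv).symm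
    rw [h3] at h2
    have h4 : κ.π.Rel (φ.pos v) (κ.pos v) := hκ ▸ NC.commonRefinement_rel.2 ⟨h1, h2⟩
    exact le_antisymm (le_pos_of_eqOn h4 hE'.symm (perm_pos _ _).le)
      (le_pos_of_eqOn h1.symm hE' (perm_pos _ _).le)

end TwoPartition

/-! ### Merging blocks along intervals -/

namespace NC

variable {n : ℕ} {x y : NC n}

/-- Merging the blocks of `y` that meet an interval `[u, v]` of the block of `m` in `x`. -/
theorem exists_merge_Icc (hxy : x ≤ y) (m u v : Fin n) : ∃ w, x ≤ w ∧ w ≤ y ∧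
    ∀ a b, w.Rel a b ↔ y.Rel a b ∨ (∃ c, (x.Rel c m ∧ u ≤ c ∧ c ≤ v) ∧ y.Rel a c) ∧
      ∃ c, (x.Rel c m ∧ u ≤ c ∧ c ≤ v) ∧ y.Rel b c := by
  refine ⟨merge hxy {e | x.Rel e m ∧ u ≤ e ∧ e ≤ v} ?_ ?_, le_merge, merge_le,
    fun a b => merge_rel⟩
  · exact fun a ha b hb => ha.1.trans hb.1.symm
  · intro a b c d hab hac ha hc hb hd h1 h2
    have ha' : x.Rel a m := hab.trans hb.1
    have hc' : x.Rel c m := hac.symm.trans ha'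
    simp only [Set.mem_ofPred_eq, ha', hc', hb.1, hd.1, true_and] at ha hc hb hd
    omega

/-- Merging the blocks of `y` that meet the complement of an open interval `(u, v)` in the block
of `m` in `x`. -/
theorem exists_merge_compl_Ioo (hxy : x ≤ y) (m u v : Fin n) : ∃ w, x ≤ w ∧ w ≤ y ∧
    ∀ a b, w.Rel a b ↔ y.Rel a b ∨ (∃ c, (x.Rel c m ∧ (c ≤ u ∨ v ≤ c)) ∧ y.Rel a c) ∧
      ∃ c, (x.Rel c m ∧ (c ≤ u ∨ v ≤ c)) ∧ y.Rel b c := by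
  refine ⟨merge hxy {e | x.Rel e m ∧ (e ≤ u ∨ v ≤ e)} ?_ ?_, le_merge, merge_le,
    fun a b => merge_rel⟩
  · exact fun a ha b hb => ha.1.trans hb.1.symm
  · intro a b c d hab hac ha hc hb hd h1 h2
    have ha' : x.Rel a m := hab.trans hb.1
    have hc' : x.Rel c m := hac.symm.trans ha'
    simp only [Set.mem_ofPred_eq, ha', hc', hb.1, hd.1, true_and] at ha hc hb hd
    omega

/-- The blocks of `y` of two neighbours in a block of `x ≤ y` can be merged. -/
theorem exists_covBy_rel (hxy : x ≤ y) {a b : Fin n} (h : x.Rel a b) (hab : a < b)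
    (hno : ∀ k, x.Rel k a → k ≤ a ∨ b ≤ k) (hy : ¬ y.Rel a b) :
    ∃ w, x ≤ w ∧ w ⋖ y ∧ w.Rel a b := by
  obtain ⟨w, hxw, hwy, hw⟩ := exists_merge_Icc hxy a a b
  have hwab : w.Rel a b := (hw a b).2 (Or.inr ⟨⟨a, ⟨Rel.refl x a, le_rfl, hab.le⟩, Rel.refl y a⟩,
    b, ⟨h.symm, hab.le, le_rfl⟩, Rel.refl y b⟩)
  have hmem : ∀ c, (x.Rel c a ∧ a ≤ c ∧ c ≤ b) → c = a ∨ c = b := fun c hc => by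
    have := hno c hc.1
    omega
  refine ⟨w, hxw, ⟨lt_of_le_of_ne hwy ?_, fun t hwt hty => ?_⟩, hwab⟩
  · rintro rfl
    exact hy hwab
  · obtain ⟨c, d, hcd, hcd'⟩ := exists_rel_not_rel hty
    have htab : t.Rel a b := by
      rcases (hw c d).1 (hcd.mono hwt.le) with h1 | ⟨⟨e, he, hce⟩, f, hf, hdf⟩
      · exact absurd h1 hcd'
      · have hef : t.Rel e f := ((hce.mono hty.le).symm.trans hcd).trans (hdf.mono hty.le)
        rcases hmem e he with rfl | rfl <;> rcases hmem f hf with rfl | rfl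
        · exact absurd (hce.trans hdf.symm) hcd'
        · exact hef
        · exact hef.symm
        · exact absurd (hce.trans hdf.symm) hcd'
    refine hwt.not_ge (le_iff_rel.2 fun i j hij => ?_)
    rcases (hw i j).1 hij with h1 | ⟨⟨e, he, hie⟩, f, hf, hjf⟩
    · exact h1.mono hty.le
    · have key : ∀ e, (x.Rel e a ∧ a ≤ e ∧ e ≤ b) → t.Rel e a := fun e he => by
        rcases hmem e he with rfl | rfl
        · exact Rel.refl t e
        · exact htab.symm
      exact ((hie.mono hty.le).trans (key e he)).trans ((hjf.mono hty.le).trans (key f hf)).symm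

end NC

/-! ### The local exchange property -/

namespace TwoPartition

variable {n : ℕ}

theorem code_lt_of_lt_pos {φ ψ : TwoPartition n} {d : Fin n}
    (h : Set.EqOn φ.perm.symm ψ.perm.symm (Set.Ioi d)) (hd : ψ.pos d < φ.pos d) :
    code φ.perm < code ψ.perm :=
  code_lt_of_eqOn h hd

theorem pos_le_of_code_le {φ ψ : TwoPartition n} {d : Fin n}
    (h : Set.EqOn φ.perm.symm ψ.perm.symm (Set.Ioi d)) (hc : code φ.perm ≤ code ψ.perm) :
    ψ.pos d ≤ φ.pos d := by
  by_contra! hlt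
  exact hc.not_gt (code_lt_of_lt_pos h.symm hlt)

/-- If the greatest value that moves in `x ⋖ y` does not move in `y ⋖ z`, then `y` may be replaced
by an element with a smaller code. -/
theorem exists_code_lt_of_eqOn_Ici {x y z : TwoPartition n} (hxy : x ⋖ y) (hyz : y ⋖ z) {d : Fin n}
    (h₁ : Set.EqOn x.perm.symm y.perm.symm (Set.Ioi d)) (hd : x.pos d ≠ y.pos d)
    (h₂ : Set.EqOn y.perm.symm z.perm.symm (Set.Ici d)) :
    ∃ y'', x ⋖ y'' ∧ y'' ⋖ z ∧ code y''.perm < code y.perm := by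
  have hxz := hxy.le.trans hyz.le
  have hq : z.pos d = y.pos d := (h₂ Set.self_mem_Ici).symm
  have hlt : y.pos d < x.pos d := lt_of_le_of_ne (pos_le_of_code_le h₁ (code_mono hxy.le)) hd.symm
  have hr : x.π.Rel (y.pos d) (x.pos d) := (rel_pos hxy.le d).symm
  obtain ⟨c, hc, hqc, hcp, hno⟩ := NC.exists_next hr hlt
  have hxz' : Set.EqOn x.perm.symm z.perm.symm (Set.Ioi d) :=
    h₁.trans (h₂.mono Set.Ioi_subset_Ici_self)
  have hcd : x.perm c ≤ d := by
    rcases hcp.eq_or_lt with rfl | hcp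
    · exact (x.perm_pos d).le
    · have := perm_lt (hc.symm.trans hr) hcp
      rw [perm_pos] at this
      exact this.le
  have hcz : ¬ z.π.Rel (y.pos d) c := fun h => by
    rw [← hq] at h hqc
    exact hqc.not_ge (le_pos_of_eqOn h.symm hxz'.symm hcd)
  -- Joining the place of `d` to its right neighbour `c` in the block of `x` lets `d` stand at `c`
  -- or further right, which makes the code less than that of `y`.
  obtain ⟨w, hxw, hwz, hw⟩ := NC.exists_covBy_rel (π_mono hxz) hc hqc hno hcz
  have hxw' : x.π ⋖ w := by
    have h3 := NC.rank_of_covBy (covBy_iff.1 hxy).2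
    have h4 := NC.rank_of_covBy (covBy_iff.1 hyz).2
    have h5 := NC.rank_of_covBy hwz
    exact NC.covBy_of_rank hxw (by omega)
  have hx : x ≤ of w z.perm := le_of_perm hxz hxw
  have hz : of w z.perm ≤ z := of_perm_le hwz.le
  have hE := eqOn_of_code_le_of_code_le (isUpperSet_Ioi d) (code_mono hx) (code_mono hz) hxz'
  refine ⟨of w z.perm, covBy_iff.2 ⟨hx, hxw'⟩, covBy_iff.2 ⟨hz, hwz⟩,
    code_lt_of_lt_pos (hE.symm.trans h₁) (hqc.trans_le ?_)⟩
  refine le_pos_of_eqOn ?_ hE.symm hcd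
  have := of_rel w z.perm d
  change w.Rel _ (z.pos d) at this
  rw [hq] at this
  exact hw.symm.trans this.symm

/-- By monotonicity of the code, any element above `y` with a code less than that of `z` may be
replaced by a cover of `y` below it. -/
theorem exists_covBy_code_lt {y z κ : TwoPartition n} (h : y < κ)
    (hc : code κ.perm < code z.perm) : ∃ z', y ⋖ z' ∧ z' ≤ κ ∧ code z'.perm < code z.perm := by
  obtain ⟨z', h1, h2⟩ := exists_covBy_le_of_finite h
  exact ⟨z', h1, h2, (code_mono h2).trans_lt hc⟩

theorem exists_join {x y y' ψ : TwoPartition n} (hxy : x ⋖ y) (hxy' : x ⋖ y') (hne : y' ≠ y)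
    (hyψ : y ≤ ψ) (hy'ψ : y' ≤ ψ) :
    ∃ κ, y < κ ∧ y' ≤ κ ∧ κ ≤ ψ ∧ κ.π = NC.commonRefinement y.π y'.π := by
  have hy'κ := le_of_perm hy'ψ (NC.le_commonRefinement_right y.π y'.π)
  refine ⟨of (NC.commonRefinement y.π y'.π) ψ.perm,
    lt_of_le_of_ne (le_of_perm hyψ (NC.le_commonRefinement_left _ _)) ?_, hy'κ,
    of_perm_le (NC.commonRefinement_le (π_mono hyψ) (π_mono hy'ψ)), rfl⟩
  rintro he
  rw [← he] at hy'κ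
  rcases hy'κ.eq_or_lt with h5 | h5
  · exact hne h5
  · exact hxy.2 hxy'.lt h5

/-- The exchange property when the same greatest value `d` moves in `x ⋖ y` and in `y ⋖ z`. -/
theorem exists_exchange_of_pos_lt {x y y' z ψ : TwoPartition n} (hxy : x ⋖ y) (hyz : y ⋖ z)
    (hxy' : x ⋖ y') (hne : y' ≠ y) (hc : code y'.perm ≤ code y.perm) (hy'ψ : y' ≤ ψ) (hzψ : z ≤ ψ)
    (hψ : ψ.π = NC.commonRefinement y'.π z.π) {d : Fin n}
    (hxyE : Set.EqOn x.perm.symm y.perm.symm (Set.Ioi d)) (hqp : y.pos d < x.pos d)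
    (hyzE : Set.EqOn y.perm.symm z.perm.symm (Set.Ioi d)) (hrq : z.pos d < y.pos d) :
    (∃ y'', x ⋖ y'' ∧ y'' ⋖ z ∧ code y''.perm < code y.perm) ∨
      ∃ z', y ⋖ z' ∧ z' ≤ ψ ∧ code z'.perm < code z.perm := by
  have hyψ := hyz.le.trans hzψ
  have hxψ := hxy.le.trans hyψ
  have hxz := hxy.le.trans hyz.le
  have hxzE := hxyE.trans hyzE
  -- All permutations involved agree above `d`. With p, q, q', r, s the positions of `d` in `x`,
  -- `y`, `y'`, `z`, `ψ`, the next lines give s ≤ r < q ≤ q' ≤ p, all in one block of `x`.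
  have hxy'E := eqOn_of_code_le_of_code_le (isUpperSet_Ioi d) (code_mono hxy'.le) hc hxyE
  have hyy'E := hxyE.symm.trans hxy'E
  have hxψE : Set.EqOn x.perm.symm ψ.perm.symm (Set.Ioi d) :=
    hxy'E.trans (eqOn_join hy'ψ hzψ hψ (isUpperSet_Ioi d) (hyy'E.symm.trans hyzE))
  have hyψE := hxyE.symm.trans hxψE
  have hsr : ψ.pos d ≤ z.pos d := pos_le_of_code_le (hyzE.symm.trans hyψE) (code_mono hzψ)
  have hqq' : y.pos d ≤ y'.pos d := pos_le_of_code_le hyy'E.symm hc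
  have hq'p : y'.pos d ≤ x.pos d := pos_le_of_code_le hxy'E (code_mono hxy'.le)
  have hsmall : ∀ e, x.π.Rel e (x.pos d) → e ≤ x.pos d → x.perm e ≤ d := by
    intro e he hle
    rcases hle.eq_or_lt with rfl | hlt
    · exact (x.perm_pos d).le
    · have := perm_lt he hlt
      rw [perm_pos] at this
      exact this.le
  -- If the block of `d` in `κ` offers a place `e` right of r that is free of greater values, then
  -- `d` stands right of r in `κ`, and the code is less than that of `z`.
  have hlater : ∀ κ, y < κ → κ ≤ ψ → (∃ e, κ.π.Rel e (κ.pos d) ∧ x.perm e ≤ d ∧ z.pos d < e) →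
      ∃ z', y ⋖ z' ∧ z' ≤ ψ ∧ code z'.perm < code z.perm := by
    rintro κ hyκ hκψ ⟨e, he, hed, hre⟩
    have hE := eqOn_of_code_le_of_code_le (isUpperSet_Ioi d) (code_mono hyκ.le) (code_mono hκψ) hyψE
    obtain ⟨z', h1, h2, h3⟩ := exists_covBy_code_lt (z := z) hyκ
      (code_lt_of_lt_pos (hE.symm.trans hyzE)
        (hre.trans_le (le_pos_of_eqOn he (hE.symm.trans hxyE.symm) hed)))
    exact ⟨z', h1, h2.trans hκψ, h3⟩
  have hpq : x.π.Rel (x.pos d) (y.pos d) := rel_pos hxy.le d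
  have hqs : y.π.Rel (y.pos d) (ψ.pos d) := rel_pos hyψ d
  have hrs : z.π.Rel (z.pos d) (ψ.pos d) := rel_pos hzψ d
  have hq's : y'.π.Rel (y'.pos d) (ψ.pos d) := rel_pos hy'ψ d
  have hpq' : ¬ y.π.Rel (x.pos d) (y.pos d) := fun h =>
    hqp.not_ge (le_pos_of_eqOn h hxyE.symm (x.perm_pos d).le)
  -- joining `y` and `y'`
  by_cases hjoin : ∃ e, y.π.Rel e (ψ.pos d) ∧ y'.π.Rel e (ψ.pos d) ∧ x.perm e ≤ d ∧ z.pos d < e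
  · obtain ⟨e, h1, h2, h3, h4⟩ := hjoin
    obtain ⟨κ, hyκ, -, hκψ, hκ⟩ := exists_join hxy hxy' hne hyψ hy'ψ
    exact Or.inr (hlater κ hyκ hκψ
      ⟨e, (hκ ▸ NC.commonRefinement_rel.2 ⟨h1, h2⟩ : κ.π.Rel _ _).trans (rel_pos hκψ d).symm,
        h3, h4⟩)
  -- merging the blocks of `z` around the positions between `ψ.pos d` and `x.pos d`
  obtain ⟨w, hxw, hwz, hw⟩ :=
    NC.exists_merge_compl_Ioo (π_mono hxz) (x.pos d) (ψ.pos d) (x.pos d)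
  have hps : x.π.Rel (ψ.pos d) (x.pos d) := (rel_pos hxψ d).symm
  have hwps : w.Rel (x.pos d) (ψ.pos d) := (hw _ _).2 (Or.inr
    ⟨⟨_, ⟨NC.Rel.refl _ _, Or.inr le_rfl⟩, NC.Rel.refl _ _⟩,
      _, ⟨hps, Or.inl le_rfl⟩, NC.Rel.refl _ _⟩)
  have hwz' : w < z.π := by
    refine lt_of_le_of_ne hwz ?_
    rintro rfl
    exact hpq' ((hwps.mono (π_mono hyz.le)).trans hqs.symm)
  -- If `w` differs from `x.π`, ranks force covers on both sides. As `w` joins s to p, `d` stays at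
  -- p or beyond, hence right of q.
  by_cases hwx : x.π < w
  · have h3 := NC.rank_of_covBy (covBy_iff.1 hxy).2
    have h4 := NC.rank_of_covBy (covBy_iff.1 hyz).2
    have h5 := NC.rank_strictMono hwx
    have h6 := NC.rank_strictMono hwz'
    have hx : x ≤ of w z.perm := le_of_perm hxz hxw
    have hz : of w z.perm ≤ z := of_perm_le hwz
    have hE := eqOn_of_code_le_of_code_le (isUpperSet_Ioi d) (code_mono hx) (code_mono hz) hxzE
    refine Or.inl ⟨of w z.perm, covBy_iff.2 ⟨hx, NC.covBy_of_rank (y := w) hxw (by omega)⟩,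
      covBy_iff.2 ⟨hz, NC.covBy_of_rank (x := w) hwz (by omega)⟩,
      code_lt_of_lt_pos (hE.symm.trans hxyE) (hqp.trans_le ?_)⟩
    refine le_pos_of_eqOn ?_ hE.symm (x.perm_pos d).le
    exact (hwps.trans (hrs.mono hwz).symm).trans (of_rel w z.perm d).symm
  -- If the merge collapses to `x.π`, it joins q to p; so the `z`-block of q must reach a point `t`
  -- outside the open interval (s, p).
  obtain ⟨t, ⟨htp, ht⟩, hqt⟩ : ∃ t, (x.π.Rel t (x.pos d) ∧ (t ≤ ψ.pos d ∨ x.pos d ≤ t)) ∧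
      z.π.Rel (y.pos d) t := by
    obtain rfl : x.π = w := hxw.eq_of_not_lt hwx
    rcases (hw _ _).1 hpq.symm with h | h
    · exact absurd (h.mono (π_mono hyz.le)).symm hpq'
    · exact h.1
  -- merging the blocks of `ψ` at the positions from `ψ.pos d` to `y.pos d`
  obtain ⟨ζ, hyζ, hζψ, hζ⟩ := NC.exists_merge_Icc (π_mono hyψ) (y.pos d) (ψ.pos d) (y.pos d)
  have hsq := hsr.trans hrq.le
  have hζsq : ζ.Rel (y.pos d) (ψ.pos d) := (hζ _ _).2 (Or.inr
    ⟨⟨_, ⟨NC.Rel.refl _ _, hsq, le_rfl⟩, NC.Rel.refl _ _⟩,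
      _, ⟨hqs.symm, le_rfl, hsq⟩, NC.Rel.refl _ _⟩)
  by_cases hyζ' : y.π < ζ
  · have hy : y ≤ of ζ ψ.perm := le_of_perm hyψ hyζ
    refine Or.inr (hlater (of ζ ψ.perm) (lt_of_le_of_ne hy fun he => hyζ'.ne (congrArg π he))
      (of_perm_le hζψ) ⟨y.pos d, hζsq.trans (of_rel ζ ψ.perm d).symm,
        hsmall _ hpq.symm hqp.le, hrq⟩)
  -- This merge collapses too, so the `ψ`-block of `t` contains some `e` in the `y`-block of q with
  -- s ≤ e ≤ q. It remains to see that `e` is one of the points excluded by `hjoin`.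
  exfalso
  obtain ⟨e, ⟨heq, hse, heq'⟩, hte⟩ : ∃ e, (y.π.Rel e (y.pos d) ∧ ψ.pos d ≤ e ∧ e ≤ y.pos d) ∧
      ψ.π.Rel t e := by
    obtain rfl : y.π = ζ := hyζ.eq_of_not_lt hyζ'
    rcases (hζ t (y.pos d)).1 (hqt.mono (π_mono hyz.le)).symm with h | h
    · exact ⟨_, ⟨NC.Rel.refl _ _, hsq, le_rfl⟩, h⟩
    · exact h.1
  have hqe : z.π.Rel (y.pos d) e := hqt.trans (hte.mono (π_mono hzψ))
  have hte' : y'.π.Rel t e := hte.mono (π_mono hy'ψ)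
  -- Otherwise s ≤ e ≤ r < q, and planarity of `z` joins q to r, although q is a place free for `d`
  -- to the right of r.
  have hre : z.pos d < e := by
    by_contra! h
    have h1 := hrs.symm.noncrossing hqe.symm hse h hrq.le
    refine hrq.not_ge (le_pos_of_eqOn ?_ hxzE.symm (hsmall _ hpq.symm hqp.le))
    exact hqe.trans (h1.symm.trans hrs.symm)
  -- `t` lies outside (s, p) and `e` in [s, q'], so planarity of `y'` merges the block of `t`, `e`
  -- with that of s, q'.
  have hes : y'.π.Rel e (ψ.pos d) := by
    rcases ht with ht | ht
    · exact hte'.symm.trans (hte'.noncrossing hq's.symm ht hse (heq'.trans hqq'))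
    · exact (hq's.symm.noncrossing hte'.symm hse (heq'.trans hqq') (hq'p.trans ht)).symm
  exact hjoin ⟨e, heq.trans hqs, hes,
    hsmall e ((heq.mono (π_mono hxy.le)).trans hpq.symm) (heq'.trans hqp.le), hre⟩

theorem ne_of_prec {Λ : Type*} [LinearOrder Λ] {lab : NC n → NC n → Λ} {x y y' : TwoPartition n}
    (h : Prec lab x y' y) : y' ≠ y := by
  rintro rfl
  rcases h with h | ⟨-, h⟩ <;> exact lt_irrefl _ h

/-- The exchange property when `y'` and `z` have a join `ψ` in the poset of noncrossing
2-partitions. -/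
theorem exists_exchange_of_join {Λ : Type*} [LinearOrder Λ] {lab : NC n → NC n → Λ}
    (hlab : IsELLabeling lab) (hinj : IsInjectiveOnCovers lab) {x y y' z ψ : TwoPartition n}
    (hxy : x ⋖ y) (hyz : y ⋖ z) (hxy' : x ⋖ y') (hp : Prec lab x y' y) (hy'ψ : y' ≤ ψ)
    (hzψ : z ≤ ψ) (hψ : ψ.π = NC.commonRefinement y'.π z.π) :
    (∃ y'', x ⋖ y'' ∧ y'' ⋖ z ∧ Prec lab x y'' y) ∨
      ∃ z', y ⋖ z' ∧ Prec lab y z' z ∧ z' ≤ ψ := by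
  have hc : code y'.perm ≤ code y.perm := by
    rcases hp with h | ⟨h, -⟩
    · exact h.le
    · exact h.le
  have hyψ := hyz.le.trans hzψ
  have hxy₁ := covBy_iff.1 hxy
  have hyz₁ := covBy_iff.1 hyz
  have hxy'₁ := covBy_iff.1 hxy'
  have h3 := NC.rank_of_covBy hxy₁.2
  have h4 := NC.rank_of_covBy hyz₁.2
  by_cases hyzp : y.perm = z.perm
  · by_cases hxyp : x.perm = y.perm
    · have hxy'p : x.perm = y'.perm :=
        code_injective (le_antisymm (code_mono hxy'.le) (hc.trans (congrArg code hxyp).ge))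
      have hψp : z.perm = ψ.perm := by
        refine Equiv.symm_bijective.injective (Equiv.ext fun v => ?_)
        have := eqOn_join hy'ψ hzψ hψ (isUpperSet_univ)
          (fun v _ => by rw [← hxy'p, hxyp, hyzp]) (Set.mem_univ v)
        rw [← this, ← hxy'p, hxyp, hyzp]
      have hxzp := hxyp.trans hyzp
      by_contra! hcon
      obtain ⟨hcon1, hcon2⟩ := hcon
      rcases hp with hp | ⟨-, hp⟩
      · rw [← hxyp, ← hxy'p] at hp
        exact lt_irrefl _ hp
      -- All permutations are equal, so only labels matter. Failure of both exchanges makes `y` and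
      -- `z` least at their two steps, hence `y` least among the atoms below `ψ`, against `y' ≺ y`.
      refine hp.not_ge (hlab.le_of_forall_le hinj hxy₁.2 hyz₁.2 (π_mono hzψ) ?_ ?_ ?_ hxy'₁.2
        (π_mono hy'ψ))
      · intro a b h5 h6 h7
        have h5 := NC.rank_of_covBy h5
        have h6 := NC.rank_of_covBy h6
        by_contra hne
        have := NC.rank_strictMono (lt_of_le_of_ne h7 hne)
        omega
      · intro a h5 h6
        by_contra! h7
        refine hcon1 (of a z.perm) (covBy_iff.2 ⟨le_of_perm (hxy.le.trans hyz.le) h5.le, h5⟩)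
          (covBy_iff.2 ⟨of_perm_le h6.le, h6⟩) (Or.inr ⟨?_, h7⟩)
        rw [← hxzp, perm_of_of_le h5.le, hxyp]
      · intro a h5 h6
        by_contra! h7
        refine hcon2 (of a ψ.perm) (covBy_iff.2 ⟨le_of_perm hyψ h5.le, h5⟩)
          (Or.inr ⟨?_, h7⟩) (of_perm_le h6)
        rw [← hψp, ← hyzp, perm_of_of_le h5.le]
    · obtain ⟨d, hd, hne⟩ := exists_eqOn_Ioi_ne hxyp
      obtain ⟨y'', h5, h6, h7⟩ :=
        exists_code_lt_of_eqOn_Ici hxy hyz hd hne fun v _ => by rw [hyzp]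
      exact Or.inl ⟨y'', h5, h6, Or.inl h7⟩
  · obtain ⟨d, hyzE, hrq⟩ := code_lt_iff.1
      (lt_of_le_of_ne (code_mono hyz.le) fun h => hyzp (code_injective h))
    have hne := ne_of_prec hp
    -- In this case the join of `y` and `y'` leaves `d` and all greater values where `y` has them,
    -- while `z` moves `d` to the left.
    by_cases hyy' : Set.EqOn y.perm.symm y'.perm.symm (Set.Ici d)
    · obtain ⟨κ, hyκ, hy'κ, hκψ, hκ⟩ := exists_join hxy hxy' hne hyψ hy'ψ
      have hE := eqOn_join hyκ.le hy'κ hκ (isUpperSet_Ici d) hyy'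
      obtain ⟨z', h5, h6, h7⟩ := exists_covBy_code_lt (z := z) hyκ
        (code_lt_of_eqOn ((hE.mono Set.Ioi_subset_Ici_self).symm.trans hyzE)
          (hE Set.self_mem_Ici ▸ hrq))
      exact Or.inr ⟨z', h5, Or.inl h7, h6.trans hκψ⟩
    have hxyE : ¬ Set.EqOn x.perm.symm y.perm.symm (Set.Ici d) := fun h =>
      hyy' (h.symm.trans
        (eqOn_of_code_le_of_code_le (isUpperSet_Ici d) (code_mono hxy'.le) hc h))
    obtain ⟨e, he, hne'⟩ := exists_eqOn_Ioi_ne (α := x.perm) (β := y.perm)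
      fun h => hxyE fun v _ => by rw [h]
    have hde : d ≤ e := by
      by_contra! h
      exact hxyE (he.mono (Set.Ici_subset_Ioi.2 h))
    rcases hde.eq_or_lt with rfl | hde
    · have hqp : y.pos d < x.pos d :=
        lt_of_le_of_ne (pos_le_of_code_le he (code_mono hxy.le)) hne'.symm
      rcases exists_exchange_of_pos_lt hxy hyz hxy' hne hc hy'ψ hzψ hψ he hqp hyzE hrq with
        ⟨y'', h5, h6, h7⟩ | ⟨z', h5, h6, h7⟩
      · exact Or.inl ⟨y'', h5, h6, Or.inl h7⟩
      · exact Or.inr ⟨z', h5, Or.inl h7, h6⟩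
    · obtain ⟨y'', h5, h6, h7⟩ := exists_code_lt_of_eqOn_Ici hxy hyz he hne'
        (hyzE.mono (Set.Ici_subset_Ioi.2 hde))
      exact Or.inl ⟨y'', h5, h6, Or.inl h7⟩

/-- Bounding `z'` by all common upper bounds of `y'` and `z` also covers the join `⊤`, where the
condition is empty. -/
theorem exists_exchange {Λ : Type*} [LinearOrder Λ] {lab : NC n → NC n → Λ}
    (hlab : IsELLabeling lab) (hinj : IsInjectiveOnCovers lab) {x y y' z : TwoPartition n}
    (hxy : x ⋖ y) (hyz : y ⋖ z) (hxy' : x ⋖ y') (hp : Prec lab x y' y) :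
    (∃ y'', x ⋖ y'' ∧ y'' ⋖ z ∧ Prec lab x y'' y) ∨
      ∃ z', y ⋖ z' ∧ Prec lab y z' z ∧ ∀ ψ, y' ≤ ψ → z ≤ ψ → z' ≤ ψ := by
  by_cases hub : ∃ χ, y' ≤ χ ∧ z ≤ χ
  · obtain ⟨χ, h1, h2⟩ := hub
    have hlub := isLUB_of_commonRefinement h1 h2
    refine (exists_exchange_of_join hlab hinj hxy hyz hxy' hp (hlub.1 (Or.inl rfl))
      (hlub.1 (Or.inr rfl)) rfl).imp_right ?_
    rintro ⟨z', h3, h4, h5⟩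
    refine ⟨z', h3, h4, fun ψ h6 h7 => h5.trans (hlub.2 ?_)⟩
    rintro _ (rfl | rfl)
    · exact h6
    · exact h7
  by_cases hyzp : y.perm = z.perm
  · have hxyp : x.perm ≠ y.perm := by
      intro hxyp
      have hc : code y'.perm ≤ code y.perm := by
        rcases hp with h | ⟨h, -⟩
        · exact h.le
        · exact h.le
      have hxy'p : x.perm = y'.perm :=
        code_injective (le_antisymm (code_mono hxy'.le) (hc.trans (congrArg code hxyp).ge))
      refine hub ⟨of (NC.commonRefinement y'.π z.π) z.perm, ?_,
        le_of_of_le (NC.le_commonRefinement_right _ _)⟩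
      rw [← hyzp, ← hxyp, hxy'p]
      exact le_of_of_le (NC.le_commonRefinement_left _ _)
    obtain ⟨d, hd, hne⟩ := exists_eqOn_Ioi_ne hxyp
    obtain ⟨y'', h5, h6, h7⟩ :=
      exists_code_lt_of_eqOn_Ici hxy hyz hd hne fun v _ => by rw [hyzp]
    exact Or.inl ⟨y'', h5, h6, Or.inl h7⟩
  · have hyz₁ := (covBy_iff.1 hyz).2
    -- With no bound to respect, the refinement of `z` can be made without moving any value.
    refine Or.inr ⟨of z.π y.perm, covBy_iff.2 ⟨le_of_of_le hyz₁.le, hyz₁⟩, Or.inl ?_,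
      fun ψ h1 h2 => absurd ⟨ψ, h1, h2⟩ hub⟩
    rw [perm_of_of_le hyz₁.le]
    exact lt_of_le_of_ne (code_mono hyz.le) fun h => hyzp (code_injective h)

theorem exists_isLUB (φ ψ : TwoPartition n) :
    ∃ j : HatTwoPartition n, IsLUB {(φ : HatTwoPartition n), (ψ : HatTwoPartition n)} j ∧
      ∀ χ : TwoPartition n, (∀ ω, φ ≤ ω → ψ ≤ ω → χ ≤ ω) → (χ : HatTwoPartition n) ≤ j := by
  by_cases hub : ∃ χ, φ ≤ χ ∧ ψ ≤ χ
  · obtain ⟨χ, h1, h2⟩ := hub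
    have hlub := isLUB_of_commonRefinement h1 h2
    have h3 := hlub.1 (Or.inl rfl)
    have h4 := hlub.1 (Or.inr rfl)
    refine ⟨_, ⟨?_, ?_⟩, fun ω hω => WithTop.coe_le_coe.2 (hω _ h3 h4)⟩
    · rintro _ (rfl | rfl)
      · exact WithTop.coe_le_coe.2 h3
      · exact WithTop.coe_le_coe.2 h4
    · intro u hu
      induction u using WithTop.recTopCoe with
      | top => exact le_top
      | coe u =>
        refine WithTop.coe_le_coe.2 (hlub.2 ?_)
        rintro _ (rfl | rfl)
        · exact WithTop.coe_le_coe.1 (hu (Or.inl rfl))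
        · exact WithTop.coe_le_coe.1 (hu (Or.inr rfl))
  · refine ⟨⊤, ⟨fun _ _ => le_top, fun u hu => ?_⟩, fun _ _ => le_top⟩
    induction u using WithTop.recTopCoe with
    | top => exact le_rfl
    | coe u =>
      exact absurd ⟨u, WithTop.coe_le_coe.1 (hu (Or.inl rfl)),
        WithTop.coe_le_coe.1 (hu (Or.inr rfl))⟩ hub

end TwoPartition

/-! ### From the local exchange property to shellings -/

section Shelling

variable {P : Type*} [PartialOrder P] [BoundedOrder P] {m : ℕ}

theorem MaximalChain.ext_elem {p q : MaximalChain P m} (h : ∀ i, p.elem i = q.elem i) : p = q := by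
  obtain ⟨e, _, _, _⟩ := p
  obtain ⟨f, _, _, _⟩ := q
  obtain rfl : e = f := funext h
  rfl

theorem MaximalChain.strictMono (p : MaximalChain P m) : StrictMono p.elem :=
  Fin.strictMono_iff_lt_succ.2 fun i => (p.covBy i).lt

theorem MaximalChain.ext_succ {p q : MaximalChain P m}
    (h : ∀ i : Fin m, p.elem i.succ = q.elem i.succ) :
    p = q := by
  refine MaximalChain.ext_elem fun i => ?_
  induction i using Fin.cases with
  | zero => rw [p.elem_zero, q.elem_zero]
  | succ i => exact h i

theorem MaximalChain.castSucc_eq {p q : MaximalChain P m} {j : Fin m}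
    (h : ∀ i < j, p.elem i.succ = q.elem i.succ) : p.elem j.castSucc = q.elem j.castSucc := by
  obtain ⟨j, hj⟩ := j
  cases j with
  | zero => exact p.elem_zero.trans q.elem_zero.symm
  | succ j => exact h ⟨j, by omega⟩ (Fin.mk_lt_mk.2 (Nat.lt_succ_self j))

variable {prec : P → P → P → Prop}

/-- Strict total orders on upper covers induce a strict total order on maximal chains. -/
theorem isStrictTotalOrder_lexLT
    (h : ∀ x : P, IsStrictTotalOrder (UpperCovers x) fun y y' => prec x y y') :
    IsStrictTotalOrder (MaximalChain P m) (LexLT prec) where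
  trichotomous p q hpq hqp := by
    by_contra hne
    have hS : ∃ j : Fin m, p.elem j.succ ≠ q.elem j.succ := by
      by_contra! hc
      exact hne (MaximalChain.ext_succ hc)
    obtain ⟨j, hj, hmin⟩ := Set.exists_min_image {j : Fin m | p.elem j.succ ≠ q.elem j.succ} id
      (Set.toFinite _) hS
    have hlt : ∀ i < j, p.elem i.succ = q.elem i.succ := fun i hi => by
      by_contra hc
      exact (hmin i hc).not_gt hi
    have he := MaximalChain.castSucc_eq hlt
    have := (h (p.elem j.castSucc)).toTrichotomous.trichotomous ⟨_, p.covBy j⟩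
      ⟨q.elem j.succ, he ▸ q.covBy j⟩
      (fun h' => hpq ⟨j, hlt, hj, he ▸ h'⟩)
      (fun h' => hqp ⟨j, fun i hi => (hlt i hi).symm, Ne.symm hj, h'⟩)
    exact hj (congrArg Subtype.val this)
  irrefl p hp := by
    obtain ⟨j, -, hj, -⟩ := hp
    exact hj rfl
  trans p q r hpq hqr := by
    obtain ⟨j, hj, hjne, hjp⟩ := hpq
    obtain ⟨k, hk, hkne, hkp⟩ := hqr
    rcases lt_trichotomy j k with hjk | rfl | hjk
    · refine ⟨j, fun i hi => (hj i hi).trans (hk i (hi.trans hjk)), hk j hjk ▸ hjne, ?_⟩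
      rw [← hk j hjk, ← MaximalChain.castSucc_eq fun i hi => hk i (hi.trans hjk)]
      exact hjp
    · have he := MaximalChain.castSucc_eq hk
      rw [← he] at hkp
      have := MaximalChain.castSucc_eq hj
      have hord := h (q.elem j.castSucc)
      have ht : prec (q.elem j.castSucc) (p.elem j.succ) (r.elem j.succ) :=
        hord.toIsStrictOrder.toIsTrans.trans ⟨_, this ▸ p.covBy j⟩ ⟨_, q.covBy j⟩
          ⟨_, he ▸ r.covBy j⟩ hjp hkp
      refine ⟨j, fun i hi => (hj i hi).trans (hk i hi), fun h' => ?_, he ▸ ht⟩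
      rw [h'] at ht
      exact hord.toIsStrictOrder.toIrrefl.irrefl ⟨_, he ▸ r.covBy j⟩ ht
    · refine ⟨k, fun i hi => (hj i (hi.trans hjk)).trans (hk i hi), (hj k hjk).symm ▸ hkne, ?_⟩
      rw [hj k hjk]
      exact hkp

/-- The local exchange property spreads along a saturated chain `f`. -/
theorem exists_exchange_between {P : Type*} [PartialOrder P] {prec : P → P → P → Prop}
    {g : P → ℕ} (hg : StrictMono g)
    (hg' : ∀ x y : P, x ⋖ y → g y = g x + 1)
    (hex : ∀ x y y' z w : P, x ⋖ y → y ⋖ z → x ⋖ y' → prec x y' y → z < w → y' ≤ w →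
      (∃ y'', x ⋖ y'' ∧ y'' ⋖ z ∧ prec x y'' y) ∨ ∃ z', y ⋖ z' ∧ z' ≤ w ∧ prec y z' z)
    {f : ℕ → P} (hf : ∀ i < m, f i ⋖ f (i + 1)) {l j : ℕ} {y' : P} (hj : j + 2 + l ≤ m)
    (hy' : f j ⋖ y') (hle : y' ≤ f (j + 2 + l)) (hp : prec (f j) y' (f (j + 1))) :
    ∃ i y'', j ≤ i ∧ i ≤ j + l ∧ f i ⋖ y'' ∧ y'' ⋖ f (i + 2) ∧ prec (f i) y'' (f (i + 1)) := by
  induction l generalizing j y' with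
  | zero =>
    -- For `l = 0` the element `y'` itself is the exchange: the grading makes it a lower cover of `f
    -- (j + 2)`.
    have h1 := hg' _ _ (hf j (by omega))
    have h2 := hg' _ _ (hf (j + 1) (by omega))
    have h3 := hg' _ _ hy'
    have hle : y' ≤ f (j + 2) := hle
    have h2 : g (f (j + 2)) = g (f (j + 1)) + 1 := h2
    refine ⟨j, y', le_rfl, le_rfl, hy', ⟨lt_of_le_of_ne hle ?_, fun c h4 h5 => ?_⟩, hp⟩
    · rintro rfl
      omega
    · have := hg h4
      have := hg h5
      omega
  | succ l ih =>
    have hmono : ∀ k, j + 2 < k → k ≤ m → f (j + 2) < f k := by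
      intro k hk hkm
      induction k, hk using Nat.le_induction with
      | base => exact (hf _ (by omega)).lt
      | succ k hk ih => exact (ih (by omega)).trans (hf _ (by omega)).lt
    rcases hex _ _ _ _ _ (hf j (by omega)) (hf (j + 1) (by omega)) hy' hp
      (hmono (j + 2 + (l + 1)) (by omega) hj) hle with ⟨y'', h1, h2, h3⟩ | ⟨z', h1, h2, h3⟩
    · exact ⟨j, y'', le_rfl, by omega, h1, h2, h3⟩
    -- `z'` precedes the next element of the chain and lies below the same upper end, so the
    -- remaining interval is shorter by one.
    · obtain ⟨i, y'', h4, h5, h6⟩ := ih (j := j + 1) (by omega) h1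
        (by rwa [show j + 1 + 2 + l = j + 2 + (l + 1) by omega]) h3
      exact ⟨i, y'', by omega, by omega, h6⟩

theorem MaximalChain.apply_elem {g : P → ℕ} (hg' : ∀ x y : P, x ⋖ y → g y = g x + 1)
    (p : MaximalChain P m) (i : Fin (m + 1)) : g (p.elem i) = g ⊥ + i := by
  induction i using Fin.induction with
  | zero => rw [p.elem_zero, Fin.val_zero, add_zero]
  | succ i ih =>
    rw [hg' _ _ (p.covBy i), ih, Fin.val_succ, Fin.val_castSucc]
    rfl

/-- Replacing one element of a maximal chain. -/
theorem MaximalChain.exists_update (p : MaximalChain P m) {i : ℕ} (hi : i + 2 ≤ m) {y : P}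
    (h₁ : p.elem ⟨i, by omega⟩ ⋖ y) (h₂ : y ⋖ p.elem ⟨i + 2, by omega⟩) :
    ∃ q : MaximalChain P m, q.elem ⟨i + 1, by omega⟩ = y ∧
      ∀ k, k ≠ ⟨i + 1, by omega⟩ → q.elem k = p.elem k := by
  have hne : ∀ k : Fin (m + 1), k.1 ≠ i + 1 →
      Function.update p.elem ⟨i + 1, by omega⟩ y k = p.elem k := fun k hk =>
    Function.update_of_ne (fun h => hk (congrArg Fin.val h)) _ _
  have hself := Function.update_self (⟨i + 1, by omega⟩ : Fin (m + 1)) y p.elem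
  refine ⟨⟨Function.update p.elem ⟨i + 1, by omega⟩ y, ?_, ?_, fun k => ?_⟩,
    hself, fun k hk => Function.update_of_ne hk _ _⟩
  · rw [hne _ (by simp), p.elem_zero]
  · rw [hne _ (by simp only [Fin.val_last]; omega), p.elem_last]
  · by_cases h3 : k.1 = i
    · rw [hne k.castSucc (by simp only [Fin.val_castSucc]; omega),
        show k.castSucc = ⟨i, by omega⟩ from Fin.ext h3,
        show k.succ = ⟨i + 1, by omega⟩ from Fin.ext (congrArg (· + 1) h3), hself]
      exact h₁
    by_cases h4 : k.1 = i + 1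
    · rw [hne k.succ (by simp only [Fin.val_succ]; omega),
        show k.castSucc = ⟨i + 1, by omega⟩ from Fin.ext h4,
        show k.succ = ⟨i + 2, by omega⟩ from Fin.ext (congrArg (· + 1) h4), hself]
      exact h₂
    · rw [hne _ h4, hne _ (by simp only [Fin.val_succ]; omega)]
      exact p.covBy k

/-- In a graded poset, strict total orders on upper covers with the local exchange property induce
a shelling. -/
theorem isShelling_lexLT {g : P → ℕ} (hg : StrictMono g)
    (hg' : ∀ x y : P, x ⋖ y → g y = g x + 1)
    (h : ∀ x : P, IsStrictTotalOrder (UpperCovers x) fun y y' => prec x y y')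
    (hex : ∀ x y y' z w : P, x ⋖ y → y ⋖ z → x ⋖ y' → prec x y' y → z < w → y' ≤ w →
      (∃ y'', x ⋖ y'' ∧ y'' ⋖ z ∧ prec x y'' y) ∨ ∃ z', y ⋖ z' ∧ z' ≤ w ∧ prec y z' z) :
    IsShelling (m := m) (LexLT prec) where
  strictTotal := isStrictTotalOrder_lexLT h
  exchange p' p hlt := by
    have heq : ∀ (p p' : MaximalChain P m) i k, p.elem i = p'.elem k → i = k := by
      intro p p' i k he
      have h1 := p.apply_elem hg' i
      rw [he, p'.apply_elem hg' k] at h1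
      exact Fin.ext (by omega)
    obtain ⟨j, hj, hne, hp⟩ := hlt
    -- `k` is the first index after `j + 1` where the chains meet again. The exchanged index `i + 1`
    -- lies strictly between `j` and `k`, so no element of `p' ∩ p` is lost.
    obtain ⟨k, hk, hmin⟩ := Set.exists_min_image
      {k : Fin (m + 1) | j.succ < k ∧ p'.elem k = p.elem k} id (Set.toFinite _)
      ⟨Fin.last m, by
        refine lt_of_le_of_ne (Fin.le_last _) fun he => ?_
        rw [he, p'.elem_last, p.elem_last] at hne
        exact hne rfl, by rw [p'.elem_last, p.elem_last]⟩
    have hjk : j.1 + 2 ≤ k.1 := Fin.lt_def.1 hk.1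
    have hkm : k.1 ≤ m := Nat.lt_succ_iff.1 k.2
    set f : ℕ → P := fun i => if hi : i < m + 1 then p.elem ⟨i, hi⟩ else ⊤ with hfdef
    have hf : ∀ i (hi : i < m + 1), f i = p.elem ⟨i, hi⟩ := fun i hi => dif_pos hi
    have hfk : f (j + 2 + (k - (j + 2))) = p.elem k := by
      rw [hf _ (by omega)]
      congr 1
      exact Fin.ext (by simp only; omega)
    have hcs := MaximalChain.castSucc_eq hj
    obtain ⟨i, y'', h1, h2, h3, h4, h5⟩ := exists_exchange_between (m := m) (f := f)
      (l := k - (j + 2)) (j := j) (y' := p'.elem j.succ) hg hg' hex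
      (fun i hi => by
        rw [hf i (by omega), hf (i + 1) (by omega)]
        exact p.covBy ⟨i, hi⟩) (by omega)
      (by
        rw [hf j (by omega)]
        change p.elem j.castSucc ⋖ _
        rw [← hcs]
        exact p'.covBy j)
      (by
        rw [hfk, ← hk.2]
        exact p'.strictMono.monotone hk.1.le)
      (by
        rw [hf j (by omega), hf (j + 1) (by omega)]
        exact hp)
    rw [hf i (by omega)] at h3 h5
    rw [hf (i + 2) (by omega)] at h4
    rw [hf (i + 1) (by omega)] at h5
    obtain ⟨q, hq, hq'⟩ := p.exists_update (by omega) h3 h4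
    have hne' : y'' ≠ p.elem ⟨i + 1, by omega⟩ := by
      rintro rfl
      exact (h _).toIsStrictOrder.toIrrefl.irrefl ⟨_, h3⟩ h5
    have hset : q.toSet ∩ p.toSet = p.toSet \ {p.elem ⟨i + 1, by omega⟩} := by
      ext a
      constructor
      · rintro ⟨⟨b, rfl⟩, c, hc⟩
        refine ⟨⟨c, hc⟩, fun hb => ?_⟩
        have := heq _ _ _ _ hb
        subst this
        exact hne' (hq.symm.trans hb)
      · rintro ⟨⟨b, rfl⟩, hb⟩
        refine ⟨⟨b, hq' b ?_⟩, b, rfl⟩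
        rintro rfl
        exact hb rfl
    refine ⟨q, ⟨⟨i, by omega⟩, fun k hk => hq' _ fun he => ?_, ?_, ?_⟩, ?_, ?_⟩
    · have h6 := congrArg Fin.val he
      have h7 := Fin.lt_def.1 hk
      simp only [Fin.val_succ] at h6 h7
      omega
    · exact fun he => hne' (hq.symm.trans he)
    · change prec _ (q.elem ⟨i + 1, _⟩) _
      rw [hq]
      exact h5
    · rw [hset, MaximalChain.toSet, Set.ncard_sdiff_singleton_of_mem (Set.mem_range_self _),
        ← Set.image_univ, Set.ncard_image_of_injective _ p.strictMono.injective, Set.ncard_univ,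
        Nat.card_eq_fintype_card, Fintype.card_fin, Nat.add_sub_cancel]
    · rintro a ⟨⟨b, hb⟩, c, hc⟩
      have h6 := heq _ _ _ _ (hb.trans hc.symm)
      subst h6
      refine ⟨b, (hq' b ?_).trans hc⟩
      rintro rfl
      rcases h1.eq_or_lt with h7 | h7
      · subst h7
        exact hne (hb.trans hc.symm)
      · have := Fin.le_def.1 (hmin ⟨i + 1, by omega⟩
          ⟨Fin.lt_def.2 (by simp only [Fin.val_succ]; omega), hb.trans hc.symm⟩)
        simp only [id] at this
        omega

end Shelling

/-- A poset graded by `g` is ranked if all maximal elements have the same degree. -/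
theorem isRankedOfLength_of_strictMono {P : Type*} [PartialOrder P] [BoundedOrder P] [Finite P]
    {m : ℕ} {g : P → ℕ} (hg : StrictMono g) (hg' : ∀ x y : P, x ⋖ y → g y = g x + 1)
    (h : g ⊤ = g ⊥ + m) : IsRankedOfLength P m := by
  intro F
  have hinj : Set.InjOn g F := by
    intro a ha b hb hab
    rcases F.le_or_le ha hb with h1 | h1
    · exact h1.eq_of_not_lt fun h2 => (hg h2).ne hab
    · exact (h1.eq_of_not_lt fun h2 => (hg h2).ne' hab).symm
  have hsurj : ∀ k, k ≤ m → ∃ a ∈ F, g a = g ⊥ + k := by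
    intro k
    induction k with
    | zero => exact fun _ => ⟨⊥, F.bot_mem, rfl⟩
    | succ k ih =>
      intro hk
      obtain ⟨a, ha, hak⟩ := ih (by omega)
      have hat : a < ⊤ := lt_top_iff_ne_top.2 (by rintro rfl; omega)
      obtain ⟨b, hb⟩ := Set.Finite.exists_minimal (Set.toFinite {b | b ∈ F ∧ a < b})
        ⟨⊤, F.top_mem, hat⟩
      refine ⟨b, hb.1.1, ?_⟩
      rw [hg' a b ⟨hb.1.2, fun c hac hcb => ?_⟩, hak, add_assoc]
      -- An element between two neighbours of the flag is comparable with the whole flag, so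
      -- maximality puts it into the flag.
      have hc : c ∈ F := by
        refine Flag.mem_iff_forall_le_or_ge.2 fun d hd => ?_
        rcases F.le_or_le ha hd with h1 | h1
        · rcases h1.eq_or_lt with rfl | h1
          · exact Or.inr hac.le
          · left
            rcases F.le_or_le hb.1.1 hd with h2 | h2
            · exact hcb.le.trans h2
            · exact hcb.le.trans (hb.2 ⟨hd, h1⟩ h2)
        · exact Or.inr (h1.trans hac.le)
      exact hcb.not_ge (hb.2 ⟨hc, hac⟩ hcb.le)
  have himage : g '' F = Set.Icc (g ⊥) (g ⊥ + m) := by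
    ext k
    constructor
    · rintro ⟨a, -, rfl⟩
      exact ⟨hg.monotone bot_le, h ▸ hg.monotone le_top⟩
    · rintro ⟨h1, h2⟩
      obtain ⟨a, ha, hak⟩ := hsurj (k - g ⊥) (by omega)
      exact ⟨a, ha, by omega⟩
  rw [← Set.InjOn.ncard_image hinj, himage, Set.ncard_eq_toFinset_card', Set.toFinset_Icc,
    Nat.card_Icc]
  omega

/-! ### The poset with the new maximum -/

namespace HatTwoPartition

variable {n : ℕ}

/-- The number of blocks; the top element has rank `n + 1`. -/
noncomputable def rank (x : HatTwoPartition n) : ℕ :=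
  WithTop.recTopCoe (C := fun _ => ℕ) (n + 1) (fun φ => φ.π.rank) x

theorem rank_coe (φ : TwoPartition n) : rank (φ : HatTwoPartition n) = φ.π.rank := rfl

theorem rank_top : rank (⊤ : HatTwoPartition n) = n + 1 := rfl

theorem _root_.NC.rank_le (x : NC n) : x.rank ≤ n := by
  have := Set.ncard_le_ncard (Set.subset_univ x.minima)
  rwa [Set.ncard_univ, Nat.card_eq_fintype_card, Fintype.card_fin] at this

theorem rank_strictMono : StrictMono (rank (n := n)) := by
  intro x y h
  induction x using WithTop.recTopCoe with
  | top => exact absurd h not_top_lt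
  | coe φ =>
    induction y using WithTop.recTopCoe with
    | top => exact Nat.lt_succ_of_le φ.π.rank_le
    | coe ψ => exact NC.rank_strictMono (TwoPartition.π_strictMono (WithTop.coe_lt_coe.1 h))

/-- Maximal noncrossing 2-partitions have `n` blocks. -/
theorem rank_eq_of_isMax {φ : TwoPartition n} (h : IsMax φ) : φ.π.rank = n := by
  rw [NC.rank, show φ.π.minima = Set.univ from ?_, Set.ncard_univ, Nat.card_eq_fintype_card,
    Fintype.card_fin]
  refine Set.eq_univ_of_forall fun a b hba hr => ?_
  have hlt := NC.lt_cut hba hr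
  have h1 := NC.rank_strictMono hlt
  have h2 := NC.rank_strictMono.monotone
    (TwoPartition.π_mono (h (TwoPartition.le_of_of_le hlt.le)))
  rw [TwoPartition.of_π] at h2
  omega

theorem isMax_of_covBy_top {φ : TwoPartition n} (h : (φ : HatTwoPartition n) ⋖ ⊤) : IsMax φ := by
  rw [isMax_iff_forall_not_lt]
  exact fun ψ hψ => h.2 (WithTop.coe_lt_coe.2 hψ) (WithTop.coe_lt_top ψ)

theorem rank_of_covBy (x y : HatTwoPartition n) (h : x ⋖ y) : rank y = rank x + 1 := by
  induction x using WithTop.recTopCoe with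
  | top => exact absurd h.lt not_top_lt
  | coe φ =>
    induction y using WithTop.recTopCoe with
    | top => rw [rank_top, rank_coe, rank_eq_of_isMax (isMax_of_covBy_top h)]
    | coe ψ =>
      exact NC.rank_of_covBy (TwoPartition.covBy_iff.1 (WithTop.coe_covBy_coe.1 h)).2

/-- Ranks run from `1` to `n + 1`, which gives length `n`. For `n = 0` the bottom would have no
block. -/
theorem rank_bot (hn : 1 ≤ n) : rank (⊥ : HatTwoPartition n) = 1 := by
  have hrel : ∀ i j, (⊥ : TwoPartition n).π.Rel i j := fun i j =>
    (TwoPartition.mem_top_parts (NC.part_mem_parts _ i)).trans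
      (TwoPartition.mem_top_parts (NC.part_mem_parts _ j)).symm
  change NC.rank (⊥ : TwoPartition n).π = 1
  rw [NC.rank, Set.ncard_eq_one]
  refine ⟨⟨0, hn⟩, Set.ext fun a => ⟨fun ha => ?_, ?_⟩⟩
  · by_contra hne
    refine ha ⟨0, hn⟩
      (lt_of_le_of_ne (Fin.mk_le_of_le_val (Nat.zero_le _)) (Ne.symm hne)) (hrel _ _)
  · rintro rfl b hb
    exact absurd hb (by simp [Fin.lt_def])

theorem isRankedOfLength (hn : 1 ≤ n) : IsRankedOfLength (HatTwoPartition n) n :=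
  haveI : Finite (HatTwoPartition n) := inferInstanceAs (Finite (Option (TwoPartition n)))
  isRankedOfLength_of_strictMono rank_strictMono rank_of_covBy
    (by rw [rank_top, rank_bot hn, add_comm])

variable {Λ : Type*} [LinearOrder Λ] {lab : NC n → NC n → Λ}

theorem prec_coe {φ ψ ψ' : TwoPartition n} :
    Prec lab (φ : HatTwoPartition n) ψ ψ' ↔ TwoPartition.Prec lab φ ψ ψ' := by
  constructor
  · rintro ⟨φ', χ, χ', h1, h2, h3, h⟩
    rwa [WithTop.coe_inj.1 h1, WithTop.coe_inj.1 h2, WithTop.coe_inj.1 h3]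
  · exact fun h => ⟨φ, ψ, ψ', rfl, rfl, rfl, h⟩

/-- Two covers that cannot be compared have the same code, hence the same permutation, and the same
label, hence the same noncrossing partition. -/
theorem isStrictTotalOrder_prec (hinj : IsInjectiveOnCovers lab) (x : HatTwoPartition n) :
    IsStrictTotalOrder (UpperCovers x) fun y y' => Prec lab x y y' where
  trichotomous := by
    rintro ⟨y, hy⟩ ⟨y', hy'⟩ h h'
    rw [Subtype.mk.injEq]
    induction x using WithTop.recTopCoe with
    | top => exact absurd hy.lt not_top_lt
    | coe φ =>
      induction y using WithTop.recTopCoe with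
      | top =>
        by_contra hne
        exact hy.2 hy'.lt (lt_top_iff_ne_top.2 (Ne.symm hne))
      | coe ψ =>
        induction y' using WithTop.recTopCoe with
        | top => exact absurd (WithTop.coe_lt_top ψ) (hy'.2 hy.lt)
        | coe ψ' =>
          rw [prec_coe] at h h'
          have hc : code ψ.perm = code ψ'.perm :=
            le_antisymm (not_lt.1 fun hl => h' (Or.inl hl)) (not_lt.1 fun hl => h (Or.inl hl))
          have hπ := hinj _ _ _ (TwoPartition.covBy_iff.1 (WithTop.coe_covBy_coe.1 hy)).2
            (TwoPartition.covBy_iff.1 (WithTop.coe_covBy_coe.1 hy')).2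
            (le_antisymm (not_lt.1 fun hl => h' (Or.inr ⟨hc.symm, hl⟩))
              (not_lt.1 fun hl => h (Or.inr ⟨hc, hl⟩)))
          rw [TwoPartition.ext_perm hπ (code_injective hc)]
  irrefl := by
    rintro ⟨y, hy⟩ ⟨φ, ψ, ψ', -, rfl, h, hp⟩
    obtain rfl := WithTop.coe_inj.1 h
    exact TwoPartition.ne_of_prec hp rfl
  trans := by
    rintro ⟨a, _⟩ ⟨b, _⟩ ⟨c, _⟩ ⟨φ, ψ, ψ', rfl, rfl, rfl, hp⟩ ⟨φ', χ, χ', h1, h2, rfl, hq⟩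
    obtain rfl := WithTop.coe_inj.1 h1
    obtain rfl := WithTop.coe_inj.1 h2
    refine prec_coe.2 ?_
    rcases hp with hp | ⟨hp, hp'⟩ <;> rcases hq with hq | ⟨hq, hq'⟩
    · exact Or.inl (hp.trans hq)
    · exact Or.inl (hp.trans_eq hq)
    · exact Or.inl (hp.trans_lt hq)
    · exact Or.inr ⟨hp.trans hq, hp'.trans hq'⟩

theorem exists_exchange (hlab : IsELLabeling lab) (hinj : IsInjectiveOnCovers lab)
    (x y y' z w : HatTwoPartition n) (hxy : x ⋖ y) (hyz : y ⋖ z) (hxy' : x ⋖ y')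
    (hp : Prec lab x y' y) (hzw : z < w) (hyw : y' ≤ w) :
    (∃ y'', x ⋖ y'' ∧ y'' ⋖ z ∧ Prec lab x y'' y) ∨
      ∃ z', y ⋖ z' ∧ z' ≤ w ∧ Prec lab y z' z := by
  obtain ⟨φ, ψ', ψ, rfl, rfl, rfl, hp⟩ := hp
  induction z using WithTop.recTopCoe with
  | top => exact absurd hzw not_top_lt
  | coe z =>
    rcases TwoPartition.exists_exchange hlab hinj (WithTop.coe_covBy_coe.1 hxy)
      (WithTop.coe_covBy_coe.1 hyz) (WithTop.coe_covBy_coe.1 hxy') hp with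
      ⟨y'', h1, h2, h3⟩ | ⟨z', h1, h2, h3⟩
    · exact Or.inl ⟨y'', WithTop.coe_covBy_coe.2 h1, WithTop.coe_covBy_coe.2 h2, prec_coe.2 h3⟩
    · refine Or.inr ⟨z', WithTop.coe_covBy_coe.2 h1, ?_, prec_coe.2 h2⟩
      induction w using WithTop.recTopCoe with
      | top => exact le_top
      | coe w =>
        exact WithTop.coe_le_coe.2 (h3 w (WithTop.coe_le_coe.1 hyw) (WithTop.coe_le_coe.1 hzw.le))

end HatTwoPartition

theorem mainTheorem1 (n : ℕ) (hn : 1 ≤ n) :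
    -- the poset is ranked of length `n`
    IsRankedOfLength (HatTwoPartition n) n ∧
    -- the explicit labeling of `NC_n` by transpositions
    ((∀ x y : NC n, x ⋖ y → (y.bar * x.bar⁻¹).IsSwap) ∧
      IsELLabeling (NC.label (n := n)) ∧ IsInjectiveOnCovers (NC.label (n := n))) ∧
    -- every EL-labeling of `NC_n` that is injective on upper covers yields a shelling
    ∀ {Λ : Type*} [LinearOrder Λ] (lab : NC n → NC n → Λ),
      IsELLabeling lab → IsInjectiveOnCovers lab →
      -- each `≺_x` is a strict total order on the upper covers of `x`
      (∀ x : HatTwoPartition n, IsStrictTotalOrder (UpperCovers x)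
        fun y y' => HatTwoPartition.Prec lab x y y') ∧
      -- the induced lexicographic order is a shelling
      IsShelling (m := n) (LexLT (HatTwoPartition.Prec lab)) ∧
      -- the local exchange property
      (∀ x y y' z : TwoPartition n, x ⋖ y → y ⋖ z → x ⋖ y' → TwoPartition.Prec lab x y' y →
        (∃ y'', x ⋖ y'' ∧ y'' ⋖ z ∧ TwoPartition.Prec lab x y'' y) ∨
        (∃ z', y ⋖ z' ∧ TwoPartition.Prec lab y z' z ∧
          ∃ j : HatTwoPartition n, IsLUB {(y' : HatTwoPartition n), (z : HatTwoPartition n)} j ∧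
            (z' : HatTwoPartition n) ≤ j)) := by
  refine ⟨HatTwoPartition.isRankedOfLength hn, ⟨fun x y h => NC.isSwap_of_covBy h,
    NC.isELLabeling_label, NC.isInjectiveOnCovers_label⟩, ?_⟩
  intro Λ _ lab hlab hinj
  refine ⟨HatTwoPartition.isStrictTotalOrder_prec hinj,
    isShelling_lexLT HatTwoPartition.rank_strictMono HatTwoPartition.rank_of_covBy
      (HatTwoPartition.isStrictTotalOrder_prec hinj)
      (HatTwoPartition.exists_exchange hlab hinj), fun x y y' z hxy hyz hxy' hp => ?_⟩
  refine (TwoPartition.exists_exchange hlab hinj hxy hyz hxy' hp).imp_right ?_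
  rintro ⟨z', h1, h2, h3⟩
  obtain ⟨j, hj, hj'⟩ := TwoPartition.exists_isLUB y' z
  exact ⟨z', h1, h2, j, hj, hj' z' h3⟩
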